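/- Fix real numbers $a_0<a_1<a_2<a_3$. For $(x,y,z)\in\mathbb R^3$ with $\rho^2=x^2+y^2+z^2$, the 5-cyclide coordinates $s_1\le s_2\le s_3$ (with $s_i\in[a_{i-1},a_i]$) are the three real zeros, counted with multiplicity, of the cubic equation $$\prod_{j=0}^3(s-a_j)\left[\frac{(\rho^2-1)^2}{s-a_0}+\frac{4x^2}{s-a_1}+\frac{4y^2}{s-a_2}+\frac{4z^2}{s-a_3}\right]=0 .$$ Put $\omega(s)=\left|\prod_{j=0}^3(s-a_j)\right|^{1/2}$, $\Omega(s)=\int_{a_0}^s \frac{d\sigma}{\omega(\sigma)}$, $b_j=\Omega(a_j)$, let $\phi:[0,b_3]\to[a_0,a_3]$ be the inverse function of $\Omega$, and for $\lambda_1,\lambda_2\in\mathbb R$ let $Q(s)=\frac{3}{16}s^2+\lambda_1 s+\lambda_2$. Let $\mathbf p=(p_1,p_2,p_3)\in\{0,1\}^3$ and $\mathbf n=(n_2,n_3)\in\mathbb N_0^2$. Let $(\lambda_1,\lambda_2)\in\mathbb R^2$ be an eigenvalue, with real-valued eigenfunctions $u_2$ on $[b_1,b_2]$ and $u_3$ on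 $[b_2,b_3]$, of the two-parameter problem $$u_2''+Q(\phi(t))\,u_2=0 \ \text{ on } [b_1,b_2],\qquad u_3''-Q(\phi(t))\,u_3=0\ \text{ on } [b_2,b_3],$$ with boundary conditions $u_2'(b_1)=0$ if $p_1=0$ and $u_2(b_1)=0$ if $p_1=1$; $u_2'(b_2)=u_3'(b_2)=0$ if $p_2=0$ and $u_2(b_2)=u_3(b_2)=0$ if $p_2=1$; $u_3'(b_3)=0$ if $p_3=0$ and $u_3(b_3)=0$ if $p_3=1$; such that $u_2$ has exactly $n_2$ zeros in $(b_1,b_2)$, $u_3$ has exactly $n_3$ zeros in $(b_2,b_3)$, and $$\int_{b_2}^{b_3}\int_{b_1}^{b_2}(\phi(t_3)-\phi(t_2))\,u_2(t_2)^2u_3(t_3)^2\,dt_2\,dt_3=1 .$$ Let $u_1$ be the solution of $u_1''-Q(\phi(t))\,u_1=0$ on $[b_0,b_1]$ with $u_1(b_1)=1$, $u_1'(b_1)=0$ if $p_1=0$, and $u_1(b_1)=0$, $u_1'(b_1)=1$ if $p_1=1$. Put $E_i(s)=u_i(\Omega(s))$ for $s\in[a_{i-1},a_i]$, $i=1,2,3$.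 Let $B_1=\{(x,y,z)\in\mathbb R^3:x^2+y^2+z^2<1\}$, and define the internal 5-cyclidic harmonic of the first kind by $$G(x,y,z)=(x^2+y^2+z^2+1)^{-1/2}E_1(s_1)E_2(s_2)E_3(s_3)\qquad\text{for } (x,y,z)\in B_1,\ x,y,z\ge 0,$$ extended to all of $B_1$ by reflection in the coordinate planes, with a factor $(-1)^{p_1}$, $(-1)^{p_2}$, $(-1)^{p_3}$ for each negative coordinate $x$, $y$, $z$ respectively. Then $G$ has parity $\mathbf p$ on $B_1$, that is, $$G(-x,y,z)=(-1)^{p_1}G(x,y,z),\quad G(x,-y,z)=(-1)^{p_2}G(x,y,z),\quad G(x,y,-z)=(-1)^{p_3}G(x,y,z),$$ and $G$ is harmonic on the whole open unit ball $B_1$ (including the points of the curves $A_1=\{s_1=s_2=a_1\}$ and $A_2=\{s_2=s_3=a_2\}$, where the coordinates fail to be analytic). -/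

import Mathlib

noncomputable section

namespace FiveCyclide

open Set Polynomial

/-- Points `(x, y, z)` of Euclidean three-space, with `x = v 0`, `y = v 1`, `z = v 2`. -/
abbrev Space : Type := EuclideanSpace ℝ (Fin 3)

/-! ### The 5-cyclide coordinates

The parameters `a₀ < a₁ < a₂ < a₃` are given by `a : Fin 4 → ℝ`. -/

/-- The numerators `((ρ² - 1)², 4x², 4y², 4z²)` of the confocal family, where
`ρ² = x² + y² + z²`. -/
def numer (v : Space) : Fin 4 → ℝ :=
  ![(v 0 ^ 2 + v 1 ^ 2 + v 2 ^ 2 - 1) ^ 2, 4 * v 0 ^ 2, 4 * v 1 ^ 2, 4 * v 2 ^ 2]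

/-- The cubic polynomial in `s`
`∏_j (s - a_j) * [(ρ²-1)²/(s-a₀) + 4x²/(s-a₁) + 4y²/(s-a₂) + 4z²/(s-a₃)]`,
with the denominators cancelled. Its leading coefficient is `(ρ² + 1)² > 0`. -/
def cubic (a : Fin 4 → ℝ) (v : Space) : ℝ[X] :=
  ∑ j : Fin 4, C (numer v j) * ∏ i ∈ Finset.univ.erase j, (X - C (a i))

/-- The 5-cyclide coordinates `s₁ ≤ s₂ ≤ s₃` of `v`: the zeros of the cubic, listed with
multiplicity in increasing order (all three zeros are real). Here `s_{i+1}` is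
`coord a v i` for `i = 0, 1, 2`. -/
def coord (a : Fin 4 → ℝ) (v : Space) (i : Fin 3) : ℝ :=
  ((cubic a v).roots.sort (· ≤ ·)).getD i 0

/-! ### The two-parameter Sturm-Liouville problem -/

/-- `ω(s) = |(s-a₀)(s-a₁)(s-a₂)(s-a₃)|^{1/2}`. -/
def omega (a : Fin 4 → ℝ) (s : ℝ) : ℝ := Real.sqrt |∏ j : Fin 4, (s - a j)|

/-- The elliptic integral `Ω(s) = ∫_{a₀}^s dσ / ω(σ)`. -/
def bigOmega (a : Fin 4 → ℝ) (s : ℝ) : ℝ := ∫ σ in (a 0)..s, 1 / omega a σ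

/-- `b_j = Ω(a_j)`. -/
def b (a : Fin 4 → ℝ) (j : Fin 4) : ℝ := bigOmega a (a j)

/-- `φ : [0, b₃] → [a₀, a₃]`, the inverse function of `Ω : [a₀, a₃] → [0, b₃]`. -/
def phi (a : Fin 4 → ℝ) : ℝ → ℝ := Function.invFunOn (bigOmega a) (Icc (a 0) (a 3))

/-- The van Vleck polynomial `Q(s) = (3/16) s² + l₁ s + l₂`. -/
def vanVleck (l₁ l₂ s : ℝ) : ℝ := 3 / 16 * s ^ 2 + l₁ * s + l₂

/-- `u` is a (twice differentiable) solution of `u'' + q u = 0` on the closed interval `[α, β]`,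
with one-sided derivatives at the end points. -/
def Solves (q u : ℝ → ℝ) (α β : ℝ) : Prop :=
  DifferentiableOn ℝ u (Icc α β) ∧
    ∀ t ∈ Icc α β,
      HasDerivWithinAt (fun x => derivWithin u (Icc α β) x) (-(q t * u t)) (Icc α β) t

/-- The boundary condition at the end point `t` of `[α, β]`: `u'(t) = 0` if `ε = 0` and
`u(t) = 0` if `ε = 1`. -/
def Boundary (ε : Fin 2) (u : ℝ → ℝ) (α β t : ℝ) : Prop :=
  (ε = 0 → derivWithin u (Icc α β) t = 0) ∧ (ε = 1 → u t = 0)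

/-- `(l₁, l₂)` is the eigenvalue with index `n = (n₂, n₃)` for the boundary conditions given by
the parity vector `p = (p₁, p₂, p₃)` (here `p 0, p 1, p 2`), `u₂` and `u₃` are corresponding
real-valued normalized eigenfunctions, and `u₁` is the corresponding solution on `[b₀, b₁]`
of the third equation. As `u₂` and `u₃` have finitely many zeros, they are nontrivial. -/
structure IsEigensystem (a : Fin 4 → ℝ) (p : Fin 3 → Fin 2) (n₂ n₃ : ℕ) (l₁ l₂ : ℝ)
    (u₁ u₂ u₃ : ℝ → ℝ) : Prop where
  solves₁ : Solves (fun t => -vanVleck l₁ l₂ (phi a t)) u₁ (b a 0) (b a 1)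
  solves₂ : Solves (fun t => vanVleck l₁ l₂ (phi a t)) u₂ (b a 1) (b a 2)
  solves₃ : Solves (fun t => -vanVleck l₁ l₂ (phi a t)) u₃ (b a 2) (b a 3)
  left₂ : Boundary (p 0) u₂ (b a 1) (b a 2) (b a 1)
  right₂ : Boundary (p 1) u₂ (b a 1) (b a 2) (b a 2)
  left₃ : Boundary (p 1) u₃ (b a 2) (b a 3) (b a 2)
  right₃ : Boundary (p 2) u₃ (b a 2) (b a 3) (b a 3)
  zeros₂ : {t ∈ Ioo (b a 1) (b a 2) | u₂ t = 0}.encard = n₂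
  zeros₃ : {t ∈ Ioo (b a 2) (b a 3) | u₃ t = 0}.encard = n₃
  normalized : ∫ t₃ in (b a 2)..(b a 3), ∫ t₂ in (b a 1)..(b a 2),
    (phi a t₃ - phi a t₂) * u₂ t₂ ^ 2 * u₃ t₃ ^ 2 = 1
  initial_even : p 0 = 0 → u₁ (b a 1) = 1 ∧ derivWithin u₁ (Icc (b a 0) (b a 1)) (b a 1) = 0
  initial_odd : p 0 = 1 → u₁ (b a 1) = 0 ∧ derivWithin u₁ (Icc (b a 0) (b a 1)) (b a 1) = 1

/-! ### The harmonics -/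

/-- `(x² + y² + z² + 1)^{-1/2} E₁(s₁) E₂(s₂) E₃(s₃)`, where `E_i(s) = u_i(Ω(s))`. -/
def separated (a : Fin 4 → ℝ) (u₁ u₂ u₃ : ℝ → ℝ) (v : Space) : ℝ :=
  (v 0 ^ 2 + v 1 ^ 2 + v 2 ^ 2 + 1) ^ (-(1 / 2) : ℝ) *
    (u₁ (bigOmega a (coord a v 0)) * u₂ (bigOmega a (coord a v 1)) *
      u₃ (bigOmega a (coord a v 2)))

/-- The reflection at the `i`-th coordinate plane. -/
def reflect (i : Fin 3) (v : Space) : Space :=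
  WithLp.toLp 2 (fun j => if j = i then -v j else v j)

/-- `f` has parity `p` on the set `D`. -/
def HasParityOn (p : Fin 3 → Fin 2) (f : Space → ℝ) (D : Set Space) : Prop :=
  ∀ v ∈ D, ∀ i : Fin 3, f (reflect i v) = (-1) ^ (p i : ℕ) * f v

/-- The point `(|x|, |y|, |z|)` of the octant `x, y, z ≥ 0`. -/
def foldOctant (v : Space) : Space := WithLp.toLp 2 (fun j => |v j|)

/-- The internal 5-cyclidic harmonic of the first kind: it is `separated` where `x, y, z ≥ 0`,
and is carried to the other octants by the reflections, with a factor `(-1)^{p_i}` for each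
negative coordinate. -/
def harmonicG (a : Fin 4 → ℝ) (p : Fin 3 → Fin 2) (u₁ u₂ u₃ : ℝ → ℝ) (v : Space) : ℝ :=
  (∏ i : Fin 3, if v i < 0 then (-1 : ℝ) ^ (p i : ℕ) else 1) *
    separated a u₁ u₂ u₃ (foldOctant v)

end FiveCyclide

end

noncomputable section

namespace FiveCyclide

open Set Filter Topology

/-! ### Frobenius series at a regular singular point -/

section PowerSeries

/-! Harmonicity off the coordinate planes. Inverse stereographic projection `theta` to the unit
sphere S³ turns the numerators into (ρ²+1)² θ_j², so the s_i are the zeros of Σ θ_j²/(s - a_j), the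
sphero-conal coordinates of S³. By conformal covariance (`laplacian_conf_rpow_mul`), (ρ²+1)^(-1/2) F
is harmonic exactly when the spherical Laplacian satisfies Δ_S F = (3/4) F. The s_i are orthogonal,
and for F = ∏ E_i(s_i) the separated equations give Δ_S F = 4 F Σ_i Q(s_i) / ∏_{k≠i} (s_i - s_k).
The sum is a second divided difference of the quadratic Q, hence its leading coefficient 3/16
whatever λ₁, λ₂ are; and 4 · 3/16 = 3/4 (`sphLap_prod_radial`).

Extension across the planes. It suffices that G is C² on the ball: then ΔG is continuous and
vanishes on a dense set. With P(s) = ∏ (s - a_j), the three equations are one Fuchsian equation P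
E'' + P' E'/2 + Q E = 0 on adjacent intervals, with exponents 0 and 1/2 at each a_j. The boundary
conditions select the exponent p_j/2, so the solutions adjacent to a_j are multiples of |s -
a_j|^(p_j/2) g(s) with one and the same analytic g (`exists_local_factor`). Evaluating the cubic at
a_j shows that the fractional powers, multiplied over the three coordinates, give a constant times
(|x_j|/(ρ²+1))^(p_j) (`prod_envelope`); the reflection signs replace |x_j| by x_j, which also yields
the parity.

There remain products of analytic functions of the s_i. A simple zero of the cubic depends smoothly
on the point. On A₁ and A₂ two zeros merge at some a_j, but g(s) g(s') is symmetric, hence a smooth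
function of s + s' and (s - s')² (`exists_contDiffAt_symmetric`), and these are smooth because the
coefficients of the cubic and its third zero are. The point a₀, where no boundary condition is
imposed, is not reached since ρ < 1. -/

lemma hasSum_coeff_mul_pow {g : ℝ → ℝ} {P : FormalMultilinearSeries ℝ ℝ ℝ} {r : ENNReal}
    (h : HasFPowerSeriesOnBall g P 0 r) {x : ℝ} (hx : x ∈ Metric.eball (0 : ℝ) r) :
    HasSum (fun n => P.coeff n * x ^ n) (g x) := by
  have := h.hasSum hx
  simpa [FormalMultilinearSeries.apply_eq_pow_smul_coeff, mul_comm] using this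

lemma HasFPowerSeriesOnBall.exists_deriv {g : ℝ → ℝ} {P : FormalMultilinearSeries ℝ ℝ ℝ}
    {r : ENNReal} (h : HasFPowerSeriesOnBall g P 0 r) :
    ∃ P' : FormalMultilinearSeries ℝ ℝ ℝ, HasFPowerSeriesOnBall (deriv g) P' 0 r ∧
      ∀ n, P'.coeff n = (n + 1) * P.coeff (n + 1) := by
  refine ⟨_, (ContinuousLinearMap.apply ℝ ℝ (1 : ℝ)).comp_hasFPowerSeriesOnBall h.fderiv, ?_⟩
  intro n
  have := P.derivSeries_coeff_one n
  simp only [nsmul_eq_mul] at this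
  push_cast at this
  rw [← this]
  rfl

/-- A three term majorant recursion forces geometric growth. -/
lemma exists_geometric_bound {c : ℕ → ℝ} {M : ℝ}
    (h : ∀ n, |c (n + 3)| ≤ M * (|c (n + 2)| + |c (n + 1)| + |c n|)) :
    ∃ B : ℝ, 1 ≤ B ∧ ∀ n, |c n| ≤ B ^ n * (|c 0| + |c 1| + |c 2|) := by
  set B := max 1 (3 * M) with hB
  have h1 : 1 ≤ B := le_max_left _ _
  have h2 : 3 * M ≤ B := le_max_right _ _
  set A := |c 0| + |c 1| + |c 2| with hA
  have hA0 : 0 ≤ A := by positivity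
  refine ⟨B, h1, ?_⟩
  have key : ∀ n, |c n| ≤ B ^ n * A ∧ |c (n + 1)| ≤ B ^ (n + 1) * A ∧
      |c (n + 2)| ≤ B ^ (n + 2) * A := by
    intro n
    induction n with
    | zero =>
      have e0 := abs_nonneg (c 0)
      have e1 := abs_nonneg (c 1)
      have e2 := abs_nonneg (c 2)
      have hB1 : A ≤ B ^ 1 * A := le_mul_of_one_le_left hA0 (one_le_pow₀ h1)
      have hB2 : A ≤ B ^ 2 * A := le_mul_of_one_le_left hA0 (one_le_pow₀ h1)
      refine ⟨by simp; linarith, ?_, ?_⟩ <;> simp only [zero_add] <;> linarith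
    | succ n ih =>
      obtain ⟨i0, i1, i2⟩ := ih
      refine ⟨i1, i2, ?_⟩
      have hM : |c (n + 3)| ≤ (3 * |M|) * (B ^ (n + 2) * A) := by
        refine (h n).trans ?_
        have hp1 : B ^ (n + 1) * A ≤ B ^ (n + 2) * A :=
          mul_le_mul_of_nonneg_right (pow_le_pow_right₀ h1 (by omega)) hA0
        have hp0 : B ^ n * A ≤ B ^ (n + 2) * A :=
          mul_le_mul_of_nonneg_right (pow_le_pow_right₀ h1 (by omega)) hA0
        calc M * (|c (n + 2)| + |c (n + 1)| + |c n|)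
            ≤ |M| * (|c (n + 2)| + |c (n + 1)| + |c n|) := by
              gcongr; exact le_abs_self M
          _ ≤ |M| * (B ^ (n + 2) * A + B ^ (n + 2) * A + B ^ (n + 2) * A) := by
              gcongr <;> linarith
          _ = _ := by ring
      rcases le_or_gt 0 M with hM0 | hM0
      · rw [abs_of_nonneg hM0] at hM
        refine hM.trans ?_
        have : B ^ (n + 1 + 2) * A = B * (B ^ (n + 2) * A) := by ring
        rw [this]
        exact mul_le_mul_of_nonneg_right h2 (by positivity)
      · have := h n
        have h0 : M * (|c (n + 2)| + |c (n + 1)| + |c n|) ≤ 0 :=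
          mul_nonpos_of_nonpos_of_nonneg hM0.le (by positivity)
        refine (this.trans h0).trans (by positivity)
  exact fun n => (key n).1

/-- A sequence with prescribed start and a linear three term recursion. -/
lemma exists_three_term (f₀ f₁ f₂ : ℕ → ℝ) :
    ∃ c : ℕ → ℝ, c 0 = 0 ∧ c 1 = 0 ∧ c 2 = 1 ∧
      ∀ n, c (n + 3) = f₂ n * c (n + 2) + f₁ n * c (n + 1) + f₀ n * c n := by
  let F : ℕ → ℝ × ℝ × ℝ := fun n => Nat.rec (0, 0, 1)
    (fun n t => (t.2.1, t.2.2, f₂ n * t.2.2 + f₁ n * t.2.1 + f₀ n * t.1)) n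
  have hs : ∀ n, F (n + 1) =
    ((F n).2.1, (F n).2.2, f₂ n * (F n).2.2 + f₁ n * (F n).2.1 + f₀ n * (F n).1) := fun n => rfl
  refine ⟨fun n => (F n).1, rfl, rfl, rfl, fun n => ?_⟩
  simp only [hs]

lemma exists_hasFPowerSeriesOnBall {c : ℕ → ℝ} {A B : ℝ} (hB : 0 < B)
    (h : ∀ n, |c n| ≤ A * B ^ n) :
    ∃ (g : ℝ → ℝ) (P : FormalMultilinearSeries ℝ ℝ ℝ) (r : ENNReal),
      HasFPowerSeriesOnBall g P 0 r ∧ ∀ n, P.coeff n = c n := by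
  set P := FormalMultilinearSeries.ofScalars ℝ c with hP
  have hr : ENNReal.ofNNReal (Real.toNNReal B⁻¹) ≤ P.radius := by
    refine P.le_radius_of_bound A fun n => ?_
    rw [hP, FormalMultilinearSeries.ofScalars_norm, Real.norm_eq_abs,
      Real.coe_toNNReal _ (inv_nonneg.2 hB.le), inv_pow]
    rw [← div_eq_mul_inv, div_le_iff₀ (by positivity)]
    exact h n
  have hpos : 0 < P.radius := lt_of_lt_of_le (by simpa using hB) hr
  exact ⟨P.sum, P, P.radius, P.hasFPowerSeriesOnBall hpos, fun n => by simp [hP]⟩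

lemma hasSum_shift {d e : ℕ → ℝ} {x s : ℝ} (h : HasSum (fun n => d n * x ^ n) s)
    (h0 : e 0 = 0) (h1 : ∀ n, e (n + 1) = d n) : HasSum (fun n => e n * x ^ n) (x * s) := by
  rw [← hasSum_nat_add_iff' 1]
  have := h.mul_left x
  simp only [Finset.range_one, Finset.sum_singleton, h0, zero_mul, sub_zero, h1]
  have e : (fun n => d n * x ^ (n + 1)) = fun n => x * (d n * x ^ n) := by funext n; ring
  rw [e]
  exact this

/-- Frobenius' theorem for the exponent `0` at a regular singular point with cubic leading
coefficient. -/
theorem exists_analytic_solution (p₀ p₁ p₂ p₃ q₀ q₁ q₂ e : ℝ) (hp : p₀ ≠ 0) (he : 0 ≤ e) :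
    ∃ g : ℝ → ℝ, AnalyticAt ℝ g 0 ∧ g 0 = 1 ∧ ∀ᶠ x in 𝓝 (0 : ℝ),
      x * (p₀ + p₁ * x + p₂ * x ^ 2 + p₃ * x ^ 3) * deriv (deriv g) x +
        ((1 / 2 + e) * (p₀ + p₁ * x + p₂ * x ^ 2 + p₃ * x ^ 3) +
          1 / 2 * x * (p₁ + 2 * p₂ * x + 3 * p₃ * x ^ 2)) * deriv g x +
        (q₀ + q₁ * x + q₂ * x ^ 2) * g x = 0 := by
  -- The coefficient of x^n in the equation involves the coefficients of g of index n + 1, n, n - 1,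
  -- n - 2, with factors D n, A₁ n, A₂ (n - 1), A₃ (n - 2). The indicial roots are 0 and 1/2 - e, so
  -- D has no zero for e ≥ 0.
  let D : ℕ → ℝ := fun n => p₀ * ((n + 1) * (n + 1 / 2 + e))
  let A₁ : ℝ → ℝ := fun n => p₁ * (n * (n + e)) + q₀
  let A₂ : ℝ → ℝ := fun n => p₂ * (n * (n + 1 / 2 + e)) + q₁
  let A₃ : ℝ → ℝ := fun n => p₃ * (n * (n + 1 + e)) + q₂
  have hD : ∀ n, D n ≠ 0 := fun n => mul_ne_zero hp (by positivity)
  -- The sequence is shifted by two: c (n + 2) is the coefficient of x^n, and c 0 = c 1 = 0 stand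
  -- for the indices -2 and -1, so that one recursion holds for every n.
  obtain ⟨c, c0, c1, c2, hc⟩ := exists_three_term (fun n => -(A₃ (n - 2) / D n))
    (fun n => -(A₂ (n - 1) / D n)) (fun n => -(A₁ n / D n))
  have hrec : ∀ n : ℕ, D n * c (n + 3) + A₁ n * c (n + 2) + A₂ (n - 1) * c (n + 1) +
      A₃ (n - 2) * c n = 0 := by
    intro n
    have := hD n
    have e1 := mul_div_cancel₀ (A₁ n) this
    have e2 := mul_div_cancel₀ (A₂ (n - 1)) this
    have e3 := mul_div_cancel₀ (A₃ (n - 2)) this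
    rw [hc]
    linear_combination -c (n + 2) * e1 - c (n + 1) * e2 - c n * e3
  -- Numerator and denominator are both quadratic in n, so the ratios in the recursion are bounded
  -- uniformly in n; geometric growth of c follows.
  have bound : ∀ (p q t : ℝ) (k : ℝ) (n : ℕ), |k| ≤ 2 → 0 ≤ t → t ≤ 1 →
      |(p * ((n - k) * (n - k + t + e)) + q) / D n| ≤
        (|p| * (6 * (4 + e)) + 2 * |q|) / |p₀| := by
    intro p q t k n hk ht ht1
    have hn : (0 : ℝ) ≤ n := Nat.cast_nonneg n
    have hd : 0 < |p₀| := abs_pos.2 hp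
    rw [abs_div, abs_mul, abs_of_nonneg (a := ((n : ℝ) + 1) * (n + 1 / 2 + e)) (by positivity),
      div_le_div_iff₀ (by positivity) hd]
    have h1 : |(n : ℝ) - k| ≤ 2 * (n + 1) := by
      rw [abs_le] at hk ⊢; constructor <;> linarith [hk.1, hk.2]
    have h2 : |(n : ℝ) - k + t + e| ≤ 3 * (4 + e) * (n + 1 / 2 + e) := by
      rw [abs_le] at hk ⊢; constructor <;> nlinarith [hk.1, hk.2, mul_nonneg hn he]
    have h3 : (1 : ℝ) ≤ 2 * ((n + 1) * (n + 1 / 2 + e)) := by nlinarith [mul_nonneg hn he]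
    have h4 : |p * ((n - k) * (n - k + t + e)) + q| ≤
        (|p| * (6 * (4 + e)) + 2 * |q|) * ((n + 1) * (n + 1 / 2 + e)) := by
      calc |p * ((n - k) * (n - k + t + e)) + q|
          ≤ |p| * (|(n : ℝ) - k| * |(n : ℝ) - k + t + e|) + |q| := by
            refine (abs_add_le _ _).trans ?_
            rw [abs_mul, abs_mul]
        _ ≤ |p| * ((2 * (n + 1)) * (3 * (4 + e) * (n + 1 / 2 + e))) +
            |q| * (2 * ((n + 1) * (n + 1 / 2 + e))) := by
            gcongr
            exact le_mul_of_one_le_right (abs_nonneg q) h3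
        _ = _ := by ring
    calc _ ≤ (|p| * (6 * (4 + e)) + 2 * |q|) * ((n + 1) * (n + 1 / 2 + e)) * |p₀| := by gcongr
      _ = _ := by ring
  obtain ⟨B, hB1, hB⟩ : ∃ B : ℝ, 1 ≤ B ∧ ∀ n, |c n| ≤ B ^ n * (|c 0| + |c 1| + |c 2|) := by
    set M₁ := (|p₁| * (6 * (4 + e)) + 2 * |q₀|) / |p₀|
    set M₂ := (|p₂| * (6 * (4 + e)) + 2 * |q₁|) / |p₀|
    set M₃ := (|p₃| * (6 * (4 + e)) + 2 * |q₂|) / |p₀|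
    have hM₁ : 0 ≤ M₁ := by positivity
    have hM₂ : 0 ≤ M₂ := by positivity
    have hM₃ : 0 ≤ M₃ := by positivity
    refine exists_geometric_bound (M := M₁ + M₂ + M₃) fun n => ?_
    have b1 : |A₁ n / D n| ≤ M₁ := by
      have := bound p₁ q₀ 0 0 n (by norm_num) le_rfl zero_le_one
      simpa [A₁] using this
    have b2 : |A₂ (n - 1) / D n| ≤ M₂ :=
      bound p₂ q₁ (1 / 2) 1 n (by norm_num) (by norm_num) (by norm_num)
    have b3 : |A₃ (n - 2) / D n| ≤ M₃ :=
      bound p₃ q₂ 1 2 n (by norm_num) (by norm_num) (by norm_num)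
    rw [hc]
    refine (abs_add_three _ _ _).trans ?_
    simp only [abs_mul, abs_neg]
    calc _ ≤ M₁ * |c (n + 2)| + M₂ * |c (n + 1)| + M₃ * |c n| := by gcongr
      _ ≤ (M₁ + M₂ + M₃) * |c (n + 2)| + (M₁ + M₂ + M₃) * |c (n + 1)| +
          (M₁ + M₂ + M₃) * |c n| := by gcongr <;> linarith
      _ = _ := by ring
  rw [c0, c1, c2] at hB
  simp only [abs_zero, abs_one, zero_add, mul_one] at hB
  obtain ⟨g, P, r, hg, hP⟩ := exists_hasFPowerSeriesOnBall (c := fun n => c (n + 2)) (A := B ^ 2)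
    (B := B) (by linarith) (fun n => by have := hB (n + 2); rw [pow_add] at this; linarith)
  obtain ⟨P', hg', hP'⟩ := HasFPowerSeriesOnBall.exists_deriv hg
  obtain ⟨P'', hg'', hP''⟩ := HasFPowerSeriesOnBall.exists_deriv hg'
  refine ⟨g, hg.analyticAt, ?_, ?_⟩
  · have := hasSum_coeff_mul_pow hg (x := 0) (by simpa using hg.r_pos)
    have h0 : HasSum (fun n => P.coeff n * (0 : ℝ) ^ n) (P.coeff 0 * 0 ^ 0) :=
      hasSum_single 0 fun n hn => by simp [hn]
    have := this.unique h0
    simpa [hP, c2] using this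
  · filter_upwards [Metric.eball_mem_nhds (0 : ℝ) hg.r_pos] with x hx
    have s0 := hasSum_coeff_mul_pow hg hx
    have s1 := hasSum_coeff_mul_pow hg' hx
    have s2 := hasSum_coeff_mul_pow hg'' hx
    simp only [hP'', hP', hP] at s0 s1 s2
    push_cast at s0 s1 s2
    -- `t2`, `t22`, ... are the series of x g'', x² g'', ..., and likewise for g' and g. All are
    -- written as series in x^n, so the equation reduces termwise to the recursion.
    have t2 := hasSum_shift (e := fun n => n * ((n + 1) * c (n + 3))) s2 (by simp)
      (fun n => by push_cast; ring)
    have t1 := hasSum_shift (e := fun n => n * c (n + 2)) s1 (by simp)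
      (fun n => by push_cast; ring)
    have t0 := hasSum_shift (e := fun n => c (n + 1)) s0 (by simp [c1]) (fun n => rfl)
    have t22 := hasSum_shift (e := fun n => (n - 1) * (n * c (n + 2))) t2 (by simp)
      (fun n => by push_cast; ring)
    have t11 := hasSum_shift (e := fun n => (n - 1) * c (n + 1)) t1 (by simp [c1])
      (fun n => by push_cast; ring)
    have t00 := hasSum_shift (e := fun n => c n) t0 (by simp [c0]) (fun n => rfl)
    have t222 := hasSum_shift (e := fun n => (n - 2) * ((n - 1) * c (n + 1))) t22 (by simp [c1])
      (fun n => by push_cast; ring)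
    have t111 := hasSum_shift (e := fun n => (n - 2) * c n) t11 (by simp [c0])
      (fun n => by push_cast; ring)
    have t2222 := hasSum_shift (e := fun n => (n - 3) * ((n - 2) * c n)) t222 (by simp [c0])
      (fun n => by push_cast; ring)
    have total := (((((t2.mul_left p₀).add (t22.mul_left p₁)).add (t222.mul_left p₂)).add
      (t2222.mul_left p₃)).add ((((s1.mul_left ((1 / 2 + e) * p₀)).add
      (t1.mul_left ((1 + e) * p₁))).add (t11.mul_left ((3 / 2 + e) * p₂))).add
      (t111.mul_left ((2 + e) * p₃)))).add
      (((s0.mul_left q₀).add (t0.mul_left q₁)).add (t00.mul_left q₂))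
    have := total.tsum_eq.symm.trans ((tsum_congr (g := fun _ => (0 : ℝ)) fun n => by
      have := hrec n
      simp only [D, A₁, A₂, A₃] at this
      linear_combination (x ^ n) * this).trans tsum_zero)
    linear_combination this

end PowerSeries

/-! ### Symmetric products of analytic functions via 2 × 2 matrices -/

section SymmetricFunctions

/-- The algebra of endomorphisms of the plane. -/
abbrev PlaneEnd : Type := (ℝ × ℝ) →L[ℝ] (ℝ × ℝ)

/-- The endomorphism `(x, y) ↦ (0, x)`. -/
def lowerShift : PlaneEnd := (0 : (ℝ × ℝ) →L[ℝ] ℝ).prod (ContinuousLinearMap.fst ℝ ℝ ℝ)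

/-- The endomorphism `(x, y) ↦ (y, 0)`. -/
def upperShift : PlaneEnd := (ContinuousLinearMap.snd ℝ ℝ ℝ).prod (0 : (ℝ × ℝ) →L[ℝ] ℝ)

/-- The endomorphism with matrix `[[h, d / ε], [ε, h]]` and eigenvalues `h ± √d`. -/
def pencil (ε : ℝ) (q : ℝ × ℝ) : PlaneEnd :=
  q.1 • (1 : PlaneEnd) + (q.2 / ε) • upperShift + ε • lowerShift

lemma pencil_apply (ε : ℝ) (q z : ℝ × ℝ) :
    pencil ε q z = (q.1 * z.1 + q.2 / ε * z.2, q.1 * z.2 + ε * z.1) := by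
  ext <;> simp [pencil, upperShift, lowerShift]

/-- The row vector (1, δ/ε) is a left eigenvector of the matrix with eigenvalue h + δ. The matrix
models multiplication by h + δ in ℝ[δ]/(δ² = d), and its entries involve only d, not δ itself. -/
lemma pencil_pow_apply {ε : ℝ} (h δ : ℝ) (hε : ε ≠ 0) (n : ℕ) :
    ((pencil ε (h, δ ^ 2) ^ n) (1, 0)).1 + δ * (((pencil ε (h, δ ^ 2) ^ n) (1, 0)).2 / ε) =
      (h + δ) ^ n := by
  induction n with
  | zero => simp
  | succ n ih =>
    rw [pow_succ' (h + δ), ← ih, pow_succ' (pencil _ _), mul_apply_eq_comp,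
      pencil_apply]
    field_simp
    ring

lemma contDiff_pencil (ε : ℝ) {n : WithTop ℕ∞} : ContDiff ℝ n (pencil ε) := by
  unfold pencil
  fun_prop

/-- This is what the conjugation by ε is for: at a double point the matrix is nilpotent but nonzero,
and scaling makes its norm smaller than the radius of convergence. -/
lemma norm_pencil (ε : ℝ) : ‖pencil ε 0‖ ≤ |ε| := by
  refine ContinuousLinearMap.opNorm_le_bound _ (abs_nonneg _) fun z => ?_
  rw [pencil_apply]
  simp only [Prod.norm_def, Prod.fst_zero, Prod.snd_zero, zero_mul, zero_div, zero_add, norm_zero,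
    norm_mul, Real.norm_eq_abs]
  exact max_le (by positivity) (by gcongr; exact le_max_left _ _)

lemma hasSum_pencil {c : ℕ → ℝ} {ε h δ s : ℝ} {X : PlaneEnd} (hε : ε ≠ 0)
    (hX : HasSum (fun n => c n • pencil ε (h, δ ^ 2) ^ n) X)
    (hs : HasSum (fun n => c n * (h + δ) ^ n) s) :
    (X (1, 0)).1 + δ * ((X (1, 0)).2 / ε) = s := by
  have hv := (ContinuousLinearMap.apply ℝ (ℝ × ℝ) ((1, 0) : ℝ × ℝ)).hasSum hX
  have h1 := (ContinuousLinearMap.fst ℝ ℝ ℝ).hasSum hv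
  have h2 := (ContinuousLinearMap.snd ℝ ℝ ℝ).hasSum hv
  have h3 := h1.add ((h2.div_const ε).mul_left δ)
  refine h3.unique ?_
  have e : (fun n => c n * (h + δ) ^ n) = fun n => c n *
      (((pencil ε (h, δ ^ 2) ^ n) (1, 0)).1 +
        δ * (((pencil ε (h, δ ^ 2) ^ n) (1, 0)).2 / ε)) := by
    funext n
    rw [pencil_pow_apply h δ hε n]
  rw [e] at hs
  convert! hs using 2 with n
  simp
  ring

/-- A convergent real power series can be evaluated in every Banach algebra. -/
lemma exists_hasSum_algebra {𝔸 : Type*} [NormedRing 𝔸] [NormedAlgebra ℝ 𝔸] [CompleteSpace 𝔸]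
    [NormOneClass 𝔸] {g : ℝ → ℝ} {a : ℝ} (hg : AnalyticAt ℝ g a) :
    ∃ (c : ℕ → ℝ) (S : 𝔸 → 𝔸) (t : ℝ), 0 < t ∧
      (∀ x, |x - a| < t → HasSum (fun n => c n * (x - a) ^ n) (g x)) ∧
      ∀ y : 𝔸, ‖y‖ < t → AnalyticAt ℝ S y ∧ HasSum (fun n => c n • y ^ n) (S y) := by
  obtain ⟨P, r, hP⟩ := hg
  set c : ℕ → ℝ := P.coeff with hc
  set S := FormalMultilinearSeries.ofScalars 𝔸 c with hS
  have hrad : r ≤ S.radius := by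
    refine hP.r_le.trans ?_
    refine ENNReal.le_of_forall_nnreal_lt fun t ht => ?_
    obtain ⟨C, -, hC⟩ := P.norm_mul_pow_le_of_lt_radius ht
    refine S.le_radius_of_bound C fun n => le_trans ?_ (hC n)
    have h2 : ‖S n‖ = ‖P n‖ := by
      rw [hS, FormalMultilinearSeries.ofScalars_norm, hc,
        FormalMultilinearSeries.norm_apply_eq_norm_coef]
    rw [h2]
  have hSsum := S.hasFPowerSeriesOnBall (lt_of_lt_of_le hP.r_pos hrad)
  obtain ⟨t, ht0, htr⟩ : ∃ t : ℝ, 0 < t ∧ ENNReal.ofReal t < r := by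
    rcases eq_or_ne r ⊤ with h | h
    · exact ⟨1, one_pos, by rw [h]; exact ENNReal.ofReal_lt_top⟩
    · have := ENNReal.toReal_pos hP.r_pos.ne' h
      refine ⟨r.toReal / 2, by positivity, ?_⟩
      rw [ENNReal.ofReal_lt_iff_lt_toReal (by positivity) h]
      linarith
  refine ⟨c, S.sum, t, ht0, fun x hx => ?_, fun y hy => ?_⟩
  · have hm : x - a ∈ Metric.eball (0 : ℝ) r := by
      rw [Metric.mem_eball, edist_zero_right, ← ofReal_norm, Real.norm_eq_abs]
      exact lt_of_le_of_lt (ENNReal.ofReal_le_ofReal hx.le) htr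
    have := hP.hasSum hm
    simpa [FormalMultilinearSeries.apply_eq_pow_smul_coeff, mul_comm] using this
  · have hm : y ∈ Metric.eball (0 : 𝔸) S.radius := by
      rw [Metric.mem_eball, edist_zero_right, ← ofReal_norm]
      exact lt_of_le_of_lt (ENNReal.ofReal_le_ofReal hy.le) (htr.trans_le hrad)
    refine ⟨hSsum.analyticAt_of_mem hm, ?_⟩
    have := hSsum.hasSum hm
    simpa [hS, FormalMultilinearSeries.ofScalars_apply_eq] using this

/-- If `g` is analytic, then `g x * g y` is a smooth function of the symmetric functions
`(x + y) / 2` and `((x - y) / 2) ^ 2`. -/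
theorem exists_contDiffAt_symmetric {g : ℝ → ℝ} {a : ℝ} (hg : AnalyticAt ℝ g a) :
    ∃ F : ℝ × ℝ → ℝ, ContDiffAt ℝ 2 F (a, 0) ∧ ∀ᶠ z : ℝ × ℝ in 𝓝 (a, a),
      g z.1 * g z.2 = F ((z.1 + z.2) / 2, ((z.1 - z.2) / 2) ^ 2) := by
  obtain ⟨c, S, t, ht, hgs, hS⟩ := exists_hasSum_algebra (𝔸 := PlaneEnd) hg
  have ht2 : t / 2 ≠ 0 := by positivity
  set M : ℝ × ℝ → PlaneEnd := fun q => pencil (t / 2) (q.1 - a, q.2) with hM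
  have hMc : ContDiff ℝ 2 M := (contDiff_pencil (t / 2)).comp (by fun_prop)
  have hM0 : ‖M (a, 0)‖ < t := by
    have := norm_pencil (t / 2)
    rw [abs_of_pos (by positivity)] at this
    have e : M (a, 0) = pencil (t / 2) 0 := by simp [hM]; rfl
    rw [e]
    linarith
  have hXc : ContDiffAt ℝ 2 (fun q => S (M q) (1, 0)) (a, 0) := by
    have : ContDiffAt ℝ 2 (fun q => S (M q)) (a, 0) :=
      ((hS _ hM0).1.contDiffAt).comp _ hMc.contDiffAt
    exact this.clm_apply contDiffAt_const
  -- With (X, Y) the first column of g(M), up to the scaling of Y, the values of g at the two points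
  -- are X + δY and X - δY. Their product X² - dY² is free of δ.
  refine ⟨fun q => (S (M q) (1, 0)).1 ^ 2 - q.2 * ((S (M q) (1, 0)).2 / (t / 2)) ^ 2, ?_, ?_⟩
  · have h0 := hXc.fst
    have h1 := hXc.snd
    fun_prop
  · have hmem : ∀ᶠ z : ℝ × ℝ in 𝓝 (a, a),
        ‖M ((z.1 + z.2) / 2, ((z.1 - z.2) / 2) ^ 2)‖ < t := by
      have hc2 : Continuous fun z : ℝ × ℝ => ‖M ((z.1 + z.2) / 2, ((z.1 - z.2) / 2) ^ 2)‖ :=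
        (hMc.continuous.comp (by fun_prop)).norm
      refine hc2.continuousAt.eventually_lt continuousAt_const ?_
      simpa using hM0
    have hb1 : ∀ᶠ z : ℝ × ℝ in 𝓝 (a, a), |z.1 - a| < t := by
      have hc3 : Continuous fun z : ℝ × ℝ => |z.1 - a| := by fun_prop
      refine hc3.continuousAt.eventually_lt continuousAt_const ?_
      simpa using ht
    have hb2 : ∀ᶠ z : ℝ × ℝ in 𝓝 (a, a), |z.2 - a| < t := by
      have hc3 : Continuous fun z : ℝ × ℝ => |z.2 - a| := by fun_prop
      refine hc3.continuousAt.eventually_lt continuousAt_const ?_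
      simpa using ht
    filter_upwards [hmem, hb1, hb2] with z hz h1 h2
    have hX := (hS _ hz).2
    set X := S (M ((z.1 + z.2) / 2, ((z.1 - z.2) / 2) ^ 2))
    have e1 : (X (1, 0)).1 + (z.1 - z.2) / 2 * ((X (1, 0)).2 / (t / 2)) = g z.1 := by
      refine hasSum_pencil ht2 (h := (z.1 + z.2) / 2 - a) hX ?_
      have e : (z.1 + z.2) / 2 - a + (z.1 - z.2) / 2 = z.1 - a := by ring
      rw [e]
      exact hgs _ h1
    have e2 : (X (1, 0)).1 + -((z.1 - z.2) / 2) * ((X (1, 0)).2 / (t / 2)) = g z.2 := by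
      refine hasSum_pencil ht2 (h := (z.1 + z.2) / 2 - a) (c := c) ?_ ?_
      · rw [neg_sq]; exact hX
      have e : (z.1 + z.2) / 2 - a + -((z.1 - z.2) / 2) = z.2 - a := by ring
      rw [e]
      exact hgs _ h2
    rw [← e1, ← e2]
    ring

end SymmetricFunctions

/-! ### Existence, continuity and smoothness of the coordinates -/

section Coordinates

/-- The product `∏_{i ≠ j} (σ - a_i)`. -/
def cofactor (a : Fin 4 → ℝ) (j : Fin 4) (σ : ℝ) : ℝ := ∏ i ∈ Finset.univ.erase j, (σ - a i)

lemma cofactor_zero (a : Fin 4 → ℝ) (σ : ℝ) :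
    cofactor a 0 σ = (σ - a 1) * (σ - a 2) * (σ - a 3) := by
  rw [cofactor, show (Finset.univ.erase (0 : Fin 4)) = {1, 2, 3} by decide]
  simp [mul_assoc]

lemma cofactor_one (a : Fin 4 → ℝ) (σ : ℝ) :
    cofactor a 1 σ = (σ - a 0) * (σ - a 2) * (σ - a 3) := by
  rw [cofactor, show (Finset.univ.erase (1 : Fin 4)) = {0, 2, 3} by decide]
  simp [mul_assoc]

lemma cofactor_two (a : Fin 4 → ℝ) (σ : ℝ) :
    cofactor a 2 σ = (σ - a 0) * (σ - a 1) * (σ - a 3) := by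
  rw [cofactor, show (Finset.univ.erase (2 : Fin 4)) = {0, 1, 3} by decide]
  simp [mul_assoc]

lemma cofactor_three (a : Fin 4 → ℝ) (σ : ℝ) :
    cofactor a 3 σ = (σ - a 0) * (σ - a 1) * (σ - a 2) := by
  rw [cofactor, show (Finset.univ.erase (3 : Fin 4)) = {0, 1, 2} by decide]
  simp [mul_assoc]

/-- The value at `σ` of the cubic with weights `w`. -/
def weighted (a w : Fin 4 → ℝ) (σ : ℝ) : ℝ := ∑ j, w j * cofactor a j σ

lemma weighted_eq (a w : Fin 4 → ℝ) (σ : ℝ) : weighted a w σ =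
    w 0 * ((σ - a 1) * (σ - a 2) * (σ - a 3)) + w 1 * ((σ - a 0) * (σ - a 2) * (σ - a 3)) +
      w 2 * ((σ - a 0) * (σ - a 1) * (σ - a 3)) + w 3 * ((σ - a 0) * (σ - a 1) * (σ - a 2)) := by
  rw [weighted, Fin.sum_univ_four, cofactor_zero, cofactor_one, cofactor_two, cofactor_three]

lemma eval_cubic (a : Fin 4 → ℝ) (v : Space) (σ : ℝ) :
    (cubic a v).eval σ = weighted a (numer v) σ := by
  simp [cubic, weighted, cofactor, Polynomial.eval_finsetSum, Polynomial.eval_prod]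

lemma weighted_self (a w : Fin 4 → ℝ) (j : Fin 4) :
    weighted a w (a j) = w j * cofactor a j (a j) := by
  rw [weighted, Finset.sum_eq_single j]
  · intro k _ hk
    rw [cofactor, Finset.prod_eq_zero (i := j) (by simp [hk.symm]) (sub_self _), mul_zero]
  · simp

/-- `s` is an interlacing triple which is the zero set of the weighted cubic. -/
def IsZeros (a w : Fin 4 → ℝ) (s : Fin 3 → ℝ) : Prop :=
  s ∈ Icc (fun i : Fin 3 => a i.castSucc) (fun i => a i.succ) ∧
    ∀ σ, weighted a w σ = (∑ j, w j) * ∏ i, (σ - s i)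

variable {a : Fin 4 → ℝ}

/-- The cubic alternates in sign at a₀, ..., a₃, which gives a zero in each open interval. Its
difference from the factored form has degree at most two and vanishes at three distinct points. -/
lemma exists_isZeros_of_pos (ha : StrictMono a) {w : Fin 4 → ℝ} (hw : ∀ j, 0 < w j) :
    ∃ s, IsZeros a w s := by
  have h01 : a 0 < a 1 := ha (by decide)
  have h12 : a 1 < a 2 := ha (by decide)
  have h23 : a 2 < a 3 := ha (by decide)
  have hcont : Continuous (weighted a w) := by
    have : weighted a w = _ := funext (weighted_eq a w)
    rw [this]
    fun_prop
  have e0 : weighted a w (a 0) < 0 := by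
    rw [weighted_self, cofactor_zero]
    have := mul_pos (hw 0) (mul_pos (mul_pos (sub_pos.2 h01) (sub_pos.2 (h01.trans h12)))
      (sub_pos.2 (h01.trans (h12.trans h23))))
    linarith
  have e1 : 0 < weighted a w (a 1) := by
    rw [weighted_self, cofactor_one]
    have := mul_pos (hw 1) (mul_pos (mul_pos (sub_pos.2 h01) (sub_pos.2 h12))
      (sub_pos.2 (h12.trans h23)))
    linarith
  have e2 : weighted a w (a 2) < 0 := by
    rw [weighted_self, cofactor_two]
    have := mul_pos (hw 2) (mul_pos (mul_pos (sub_pos.2 (h01.trans h12)) (sub_pos.2 h12))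
      (sub_pos.2 h23))
    linarith
  have e3 : 0 < weighted a w (a 3) := by
    rw [weighted_self, cofactor_three]
    exact mul_pos (hw 3) (mul_pos (mul_pos (sub_pos.2 (h01.trans (h12.trans h23)))
      (sub_pos.2 (h12.trans h23))) (sub_pos.2 h23))
  obtain ⟨x, hx, hx0⟩ := intermediate_value_Ioo h01.le hcont.continuousOn ⟨e0, e1⟩
  obtain ⟨y, hy, hy0⟩ := intermediate_value_Ioo' h12.le hcont.continuousOn ⟨e2, e1⟩
  obtain ⟨z, hz, hz0⟩ := intermediate_value_Ioo h23.le hcont.continuousOn ⟨e2, e3⟩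
  refine ⟨![x, y, z], ⟨?_, ?_⟩, ?_⟩
  · intro i; fin_cases i
    exacts [hx.1.le, hy.1.le, hz.1.le]
  · intro i; fin_cases i
    exacts [hx.2.le, hy.2.le, hz.2.le]
  · obtain ⟨A, B, C, hd⟩ : ∃ A B C : ℝ, ∀ σ, weighted a w σ -
        (∑ j, w j) * ∏ i, (σ - ![x, y, z] i) = A * σ ^ 2 + B * σ + C := by
      refine ⟨(w 0 * -(a 1 + a 2 + a 3) + w 1 * -(a 0 + a 2 + a 3) + w 2 * -(a 0 + a 1 + a 3) +
          w 3 * -(a 0 + a 1 + a 2)) + (w 0 + w 1 + w 2 + w 3) * (x + y + z),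
        w 0 * (a 1 * a 2 + a 1 * a 3 + a 2 * a 3) + w 1 * (a 0 * a 2 + a 0 * a 3 + a 2 * a 3)
          + w 2 * (a 0 * a 1 + a 0 * a 3 + a 1 * a 3) + w 3 * (a 0 * a 1 + a 0 * a 2 + a 1 * a 2)
          - (w 0 + w 1 + w 2 + w 3) * (x * y + x * z + y * z),
        -(w 0 * (a 1 * a 2 * a 3) + w 1 * (a 0 * a 2 * a 3) + w 2 * (a 0 * a 1 * a 3) +
          w 3 * (a 0 * a 1 * a 2)) + (w 0 + w 1 + w 2 + w 3) * (x * y * z), fun σ => ?_⟩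
      rw [weighted_eq, Fin.sum_univ_four, Fin.prod_univ_three]
      simp only [Matrix.cons_val]
      ring
    have dx := hd x
    have dy := hd y
    have dz := hd z
    rw [hx0] at dx
    rw [hy0] at dy
    rw [hz0] at dz
    simp only [Fin.prod_univ_three, Matrix.cons_val, sub_self, mul_zero, zero_mul] at dx dy dz
    have hxy : x - y ≠ 0 := by have := hx.2.trans hy.1; linarith
    have hyz : y - z ≠ 0 := by have := hy.2.trans hz.1; linarith
    have hxz : x - z ≠ 0 := by have := (hx.2.trans hy.1).trans (hy.2.trans hz.1); linarith
    have f1 : A * (x + y) + B = 0 := by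
      apply mul_left_cancel₀ hxy; linear_combination dy - dx
    have f2 : A * (y + z) + B = 0 := by
      apply mul_left_cancel₀ hyz; linear_combination dz - dy
    have hA : A = 0 := by
      apply mul_left_cancel₀ hxz; linear_combination f1 - f2
    have hB : B = 0 := by rw [hA] at f1; linarith
    have hC : C = 0 := by rw [hA, hB] at dx; linarith
    intro σ
    have := hd σ
    rw [hA, hB, hC] at this
    linarith

/-- Being the zero triple is a closed condition on (w, s), and projecting along the compact box of
interlacing triples is a closed map. This serves both for degenerate weights and for the continuity
of the coordinates. -/
lemma isClosed_isZeros (a : Fin 4 → ℝ) (C : Set (Fin 3 → ℝ)) (hC : IsClosed C) :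
    IsClosed {w | ∃ s ∈ C, IsZeros a w s} := by
  let box := Icc (fun i : Fin 3 => a i.castSucc) (fun i => a i.succ)
  have : CompactSpace box := isCompact_iff_compactSpace.1 isCompact_Icc
  have h1 : IsClosed {q : (Fin 4 → ℝ) × box | (q.2 : Fin 3 → ℝ) ∈ C ∧
      ∀ σ, weighted a q.1 σ = (∑ j, q.1 j) * ∏ i, (σ - (q.2 : Fin 3 → ℝ) i)} := by
    have h0 : {q : (Fin 4 → ℝ) × box | ∀ σ, weighted a q.1 σ =
        (∑ j, q.1 j) * ∏ i, (σ - (q.2 : Fin 3 → ℝ) i)} = ⋂ σ, {q | weighted a q.1 σ =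
        (∑ j, q.1 j) * ∏ i, (σ - (q.2 : Fin 3 → ℝ) i)} := by
      ext; simp
    have h2 : IsClosed {q : (Fin 4 → ℝ) × box | ∀ σ, weighted a q.1 σ =
        (∑ j, q.1 j) * ∏ i, (σ - (q.2 : Fin 3 → ℝ) i)} := by
      rw [h0]
      refine isClosed_iInter fun σ => isClosed_eq ?_ ?_
      · unfold weighted; fun_prop
      · have : ∀ i : Fin 3, Continuous fun q : (Fin 4 → ℝ) × box => (q.2 : Fin 3 → ℝ) i :=
          fun i => (continuous_apply i).comp (continuous_subtype_val.comp continuous_snd)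
        fun_prop
    have h3 : IsClosed {q : (Fin 4 → ℝ) × box | (q.2 : Fin 3 → ℝ) ∈ C} :=
      hC.preimage (by fun_prop)
    exact h3.inter h2
  have h2 := isClosedMap_fst_of_compactSpace _ h1
  convert h2 using 1
  ext w
  constructor
  · rintro ⟨s, hs, hb, h⟩
    exact ⟨(w, ⟨s, hb⟩), ⟨hs, h⟩, rfl⟩
  · rintro ⟨⟨w', ⟨s, hb⟩⟩, ⟨hs, h⟩, rfl⟩
    exact ⟨s, hs, hb, h⟩

/-- Limit of the weights w + t as t decreases to 0. Vanishing weights occur on the coordinate planes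
and on the unit sphere. -/
lemma exists_isZeros (ha : StrictMono a) {w : Fin 4 → ℝ} (hw : ∀ j, 0 ≤ w j) :
    ∃ s, IsZeros a w s := by
  have hcl := isClosed_isZeros a univ isClosed_univ
  have ht : Tendsto (fun t : ℝ => fun j => w j + t) (𝓝[>] 0) (𝓝 w) := by
    have : Continuous (fun t : ℝ => fun j => w j + t) := by fun_prop
    have h := (this.tendsto 0).mono_left (nhdsWithin_le_nhds (s := Ioi 0))
    simpa using h
  have := hcl.mem_of_tendsto ht (by
    filter_upwards [self_mem_nhdsWithin] with t ht
    obtain ⟨s, hs⟩ := exists_isZeros_of_pos ha (w := fun j => w j + t)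
      (fun j => add_pos_of_nonneg_of_pos (hw j) ht)
    exact ⟨s, mem_univ _, hs⟩)
  obtain ⟨s, -, hs⟩ := this
  exact ⟨s, hs⟩

lemma numer_nonneg (v : Space) (j : Fin 4) : 0 ≤ numer v j := by
  fin_cases j <;> simp [numer] <;> positivity

/-- The conformal factor `ρ² + 1`. -/
def conf (v : Space) : ℝ := v 0 ^ 2 + v 1 ^ 2 + v 2 ^ 2 + 1

lemma conf_pos (v : Space) : 0 < conf v := by unfold conf; positivity

lemma sum_numer (v : Space) : ∑ j, numer v j = conf v ^ 2 := by
  simp [Fin.sum_univ_four, numer, conf]; ring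

lemma coord_eq_of_isZeros {v : Space} {s : Fin 3 → ℝ}
    (hs : IsZeros a (numer v) s) : coord a v = s := by
  have h12 : s 0 ≤ s 1 := (hs.1.2 0).trans (hs.1.1 1)
  have h23 : s 1 ≤ s 2 := (hs.1.2 1).trans (hs.1.1 2)
  have hK : conf v ^ 2 ≠ 0 := (pow_pos (conf_pos v) 2).ne'
  have hc : cubic a v = Polynomial.C (conf v ^ 2) *
      (Multiset.map (fun x => Polynomial.X - Polynomial.C x)
        (([s 0, s 1, s 2] : List ℝ) : Multiset ℝ)).prod := by
    apply Polynomial.funext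
    intro σ
    rw [eval_cubic, hs.2, sum_numer, Fin.prod_univ_three]
    simp [mul_assoc]
  funext i
  rw [coord, hc, Polynomial.roots_C_mul _ hK, Polynomial.roots_multiset_prod_X_sub_C,
    Multiset.coe_sort, List.mergeSort_eq_self]
  · fin_cases i <;> rfl
  · simp [h12, h23, h12.trans h23]

lemma isZeros_coord (ha : StrictMono a) (v : Space) : IsZeros a (numer v) (coord a v) := by
  obtain ⟨s, hs⟩ := exists_isZeros ha (numer_nonneg v)
  rwa [coord_eq_of_isZeros hs]

lemma contDiff_numer {n : WithTop ℕ∞} (j : Fin 4) : ContDiff ℝ n fun v => numer v j := by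
  fin_cases j <;> simp [numer] <;> fun_prop

lemma contDiff_conf {n : WithTop ℕ∞} : ContDiff ℝ n conf := by
  unfold conf; fun_prop

/-- Since the zero triple is unique, the preimage of a closed set C is the preimage under `numer` of
the closed set in `isClosed_isZeros`. This holds at multiple zeros too. -/
lemma continuous_coord (ha : StrictMono a) : Continuous (coord a) := by
  have hn : Continuous numer := continuous_pi fun j => (contDiff_numer (n := 0) j).continuous
  refine continuous_iff_isClosed.2 fun C hC => ?_
  have := (isClosed_isZeros a C hC).preimage hn
  convert this using 1
  ext v
  constructor
  · exact fun h => ⟨_, h, isZeros_coord ha v⟩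
  · rintro ⟨s, hs, h⟩
    rw [mem_preimage, coord_eq_of_isZeros h]
    exact hs

lemma weighted_numer (ha : StrictMono a) (v : Space) (σ : ℝ) :
    weighted a (numer v) σ = conf v ^ 2 * ∏ i, (σ - coord a v i) := by
  rw [(isZeros_coord ha v).2, sum_numer]

lemma coord_mem_Icc (ha : StrictMono a) (v : Space) (i : Fin 3) :
    coord a v i ∈ Icc (a i.castSucc) (a i.succ) :=
  ⟨(isZeros_coord ha v).1.1 i, (isZeros_coord ha v).1.2 i⟩

lemma contDiff_weighted (a : Fin 4 → ℝ) {n : WithTop ℕ∞} :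
    ContDiff ℝ n fun q : Space × ℝ => weighted a (numer q.1) q.2 := by
  have h : ∀ j, ContDiff ℝ n fun q : Space × ℝ => numer q.1 j :=
    fun j => (contDiff_numer j).comp contDiff_fst
  have h0 := h 0
  have h1 := h 1
  have h2 := h 2
  have h3 := h 3
  simp only [weighted_eq]
  fun_prop

/-- A coordinate which is a simple zero of the cubic is a smooth function of the point. -/
lemma contDiffAt_coord (ha : StrictMono a) {v : Space} {i : Fin 3}
    (hi : ∀ k ≠ i, coord a v k ≠ coord a v i) : ContDiffAt ℝ 2 (fun v => coord a v i) v := by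
  set s := coord a v i with hs
  set f : Space × ℝ → ℝ := fun q => weighted a (numer q.1) q.2 with hf
  have cdf : ContDiffAt ℝ 2 f (v, s) := (contDiff_weighted a).contDiffAt
  have hfs : ∀ w, f (w, coord a w i) = 0 := fun w => by
    simp only [hf]
    rw [weighted_numer ha, Finset.prod_eq_zero (Finset.mem_univ i) (sub_self _), mul_zero]
  -- The derivative of the cubic at its zero s, nonzero because s is simple. The implicit function
  -- theorem applies, and continuity of the coordinate identifies it with the implicit function.
  set d := conf v ^ 2 * ∏ k ∈ Finset.univ.erase i, (s - coord a v k) with hd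
  have hd0 : d ≠ 0 := mul_ne_zero (pow_pos (conf_pos v) 2).ne' <| Finset.prod_ne_zero_iff.2
    fun k hk => sub_ne_zero.2 (hi k (Finset.ne_of_mem_erase hk)).symm
  have hder : HasDerivAt (fun σ => f (v, σ)) d s := by
    have h1 : (fun σ => f (v, σ)) = fun σ => (σ - coord a v i) *
        (conf v ^ 2 * ∏ k ∈ Finset.univ.erase i, (σ - coord a v k)) := by
      funext σ
      simp only [hf]
      rw [weighted_numer ha, ← Finset.mul_prod_erase _ _ (Finset.mem_univ i)]
      ring
    have hq : DifferentiableAt ℝ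
        (fun σ => conf v ^ 2 * ∏ k ∈ Finset.univ.erase i, (σ - coord a v k)) s := by
      fun_prop
    rw [h1]
    have := ((hasDerivAt_id s).sub_const (coord a v i)).mul hq.hasDerivAt
    exact this.congr_deriv (by simp [hd, hs])
  have hcomp : fderiv ℝ f (v, s) ∘L .inr ℝ Space ℝ =
      (ContinuousLinearEquiv.unitsEquivAut ℝ (Units.mk0 d hd0) : ℝ →L[ℝ] ℝ) := by
    have h1 : HasFDerivAt (fun σ => f (v, σ)) (fderiv ℝ f (v, s) ∘L .inr ℝ Space ℝ) s := by
      have h2 := (cdf.differentiableAt (by norm_num)).hasFDerivAt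
      exact h2.comp s (hasFDerivAt_prodMk_right v s)
    have h3 := h1.hasDerivAt.unique hder
    ext
    simpa using h3
  have hinv : (fderiv ℝ f (v, s) ∘L .inr ℝ Space ℝ).IsInvertible := ⟨_, hcomp.symm⟩
  have h2 : (2 : WithTop ℕ∞) ≠ 0 := by norm_num
  refine (cdf.contDiffAt_implicitFunction h2 hinv).congr_of_eventuallyEq ?_
  have ht : Tendsto (fun w => (w, coord a w i)) (𝓝 v) (𝓝 (v, s)) := by
    have h := (continuous_coord ha)
    have : Continuous fun w => (w, coord a w i) := by fun_prop
    exact this.tendsto v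
  filter_upwards [ht.eventually (cdf.eventually_apply_eq_iff_implicitFunction h2 hinv)] with w hw
  exact (hw.1 (by rw [hfs, hs, hfs])).symm

end Coordinates

/-! ### The elliptic integral Ω and its inverse -/

section EllipticIntegral

open MeasureTheory

/-- The quartic `∏_j (s - a_j)`. -/
def nodal (a : Fin 4 → ℝ) (s : ℝ) : ℝ := ∏ j, (s - a j)

lemma nodal_eq (a : Fin 4 → ℝ) (j : Fin 4) (s : ℝ) : nodal a s = (s - a j) * cofactor a j s := by
  exact (Finset.mul_prod_erase _ (fun i => s - a i) (Finset.mem_univ j)).symm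

lemma continuous_cofactor (a : Fin 4 → ℝ) (j : Fin 4) : Continuous (cofactor a j) := by
  unfold cofactor; fun_prop

lemma continuous_nodal (a : Fin 4 → ℝ) : Continuous (nodal a) := by
  unfold nodal; fun_prop

lemma omega_def (a : Fin 4 → ℝ) (s : ℝ) : omega a s = √|nodal a s| := rfl

lemma continuous_omega (a : Fin 4 → ℝ) : Continuous (omega a) := by
  have : omega a = fun s => √|nodal a s| := rfl
  rw [this]
  exact (continuous_nodal a).abs.sqrt

lemma nodal_ne_zero_iff {a : Fin 4 → ℝ} {s : ℝ} : nodal a s ≠ 0 ↔ ∀ j, s ≠ a j := by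
  simp [nodal, Finset.prod_ne_zero_iff, sub_ne_zero]

lemma omega_pos {a : Fin 4 → ℝ} {s : ℝ} (h : nodal a s ≠ 0) : 0 < omega a s :=
  Real.sqrt_pos.2 (abs_pos.2 h)

lemma cofactor_self_ne_zero {a : Fin 4 → ℝ} (ha : StrictMono a) (j : Fin 4) :
    cofactor a j (a j) ≠ 0 :=
  Finset.prod_ne_zero_iff.2 fun _ hk =>
    sub_ne_zero.2 fun h => Finset.ne_of_mem_erase hk (ha.injective h).symm

/-- On negative reals `Real.rpow` carries the factor cos(-π/2) = 0 for this exponent, so each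
summand lives on one half line; at 0 every term is 0 by convention. Integrability thus follows from
that of power functions. -/
lemma inv_sqrt_abs_eq (x : ℝ) :
    (√|x|)⁻¹ = x ^ (-(1 / 2) : ℝ) + (-x) ^ (-(1 / 2) : ℝ) := by
  have hcos : Real.cos (-(1 / 2) * Real.pi) = 0 := by
    rw [show -(1 / 2) * Real.pi = -(Real.pi / 2) by ring, Real.cos_neg, Real.cos_pi_div_two]
  rcases lt_trichotomy x 0 with h | h | h
  · rw [abs_of_neg h, Real.rpow_def_of_neg h, hcos, mul_zero, zero_add,
      Real.rpow_neg (by linarith), Real.sqrt_eq_rpow]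
  · subst h; simp
  · rw [abs_of_pos h, Real.rpow_def_of_neg (neg_neg_of_pos h), hcos, mul_zero, add_zero,
      Real.rpow_neg h.le, Real.sqrt_eq_rpow]

lemma intervalIntegrable_inv_sqrt_abs (c l u : ℝ) :
    IntervalIntegrable (fun s => (√|s - c|)⁻¹) volume l u := by
  have h : ∀ l u : ℝ, IntervalIntegrable (fun s => (√|s|)⁻¹) volume l u := by
    intro l u
    have e : (fun s : ℝ => (√|s|)⁻¹) =
        fun s => s ^ (-(1 / 2) : ℝ) + (-s) ^ (-(1 / 2) : ℝ) := funext inv_sqrt_abs_eq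
    rw [e]
    have h1 := intervalIntegral.intervalIntegrable_rpow' (a := l) (b := u)
      (r := -(1 / 2)) (by norm_num)
    have h2 := intervalIntegral.intervalIntegrable_rpow' (a := -l) (b := -u)
      (r := -(1 / 2)) (by norm_num)
    exact h1.add (by simpa using (IntervalIntegrable.iff_comp_neg (by simp)).1 h2)
  simpa using (h (l - c) (u - c)).comp_sub_right c

/-- Away from the nodes √|C_j|/ω = 1/√|s - a_j|, where C_j is the j-th cofactor. Summing over j
expresses 1/ω through the integrable singularities 1/√|s - a_j| and the factor 1/H, which is
continuous because the cofactors have no common zero. -/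
lemma intervalIntegrable_inv_omega {a : Fin 4 → ℝ} (ha : StrictMono a) (l u : ℝ) :
    IntervalIntegrable (fun s => 1 / omega a s) volume l u := by
  set H : ℝ → ℝ := fun s => ∑ j, √|cofactor a j s| with hH
  have hHc : Continuous H := by
    have := continuous_cofactor a
    simp only [hH]
    fun_prop
  have hHp : ∀ s, 0 < H s := by
    intro s
    by_cases h : ∃ j, s = a j
    · obtain ⟨j, rfl⟩ := h
      exact Finset.sum_pos' (fun _ _ => Real.sqrt_nonneg _)
        ⟨j, Finset.mem_univ j, Real.sqrt_pos.2 (abs_pos.2 (cofactor_self_ne_zero ha j))⟩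
    · push Not at h
      refine Finset.sum_pos' (fun _ _ => Real.sqrt_nonneg _)
        ⟨0, Finset.mem_univ 0, Real.sqrt_pos.2 (abs_pos.2 ?_)⟩
      have := nodal_ne_zero_iff.2 h
      rw [nodal_eq a 0] at this
      exact right_ne_zero_of_mul this
  have hR : IntervalIntegrable (fun s => (H s)⁻¹ * ∑ j, (√|s - a j|)⁻¹) volume l u := by
    have h1 : IntervalIntegrable (fun s => ∑ j, (√|s - a j|)⁻¹) volume l u := by
      have := IntervalIntegrable.sum (μ := volume) (a := l) (b := u) Finset.univ
        (f := fun (j : Fin 4) s => (√|s - a j|)⁻¹)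
        (fun j _ => intervalIntegrable_inv_sqrt_abs (a j) l u)
      rwa [show (∑ j : Fin 4, fun s => (√|s - a j|)⁻¹) = fun s => ∑ j, (√|s - a j|)⁻¹ from by
        ext; simp] at this
    refine h1.continuousOn_mul ?_
    exact (hHc.inv₀ fun s => (hHp s).ne').continuousOn
  refine hR.mono_fun ?_ ?_
  · exact (measurable_const.div (continuous_omega a).measurable).aestronglyMeasurable
  · refine Eventually.of_forall fun s => ?_
    by_cases h : nodal a s = 0
    · simp only [omega_def, h, abs_zero, Real.sqrt_zero, div_zero, norm_zero]
      positivity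
    · have hw := omega_pos h
      have : 1 / omega a s = (H s)⁻¹ * ∑ j, (√|s - a j|)⁻¹ := by
        rw [eq_inv_mul_iff_mul_eq₀ (hHp s).ne', hH, Finset.sum_mul]
        refine Finset.sum_congr rfl fun j _ => ?_
        have h2 := h
        rw [nodal_eq a j] at h2
        have h3 := Real.sqrt_pos.2 (abs_pos.2 (left_ne_zero_of_mul h2))
        have h4 := Real.sqrt_pos.2 (abs_pos.2 (right_ne_zero_of_mul h2))
        rw [omega_def, nodal_eq a j, abs_mul, Real.sqrt_mul (abs_nonneg _)]
        field_simp
      exact (congrArg norm this).le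

lemma continuous_bigOmega {a : Fin 4 → ℝ} (ha : StrictMono a) : Continuous (bigOmega a) :=
  intervalIntegral.continuous_primitive (intervalIntegrable_inv_omega ha) _

lemma hasDerivAt_bigOmega {a : Fin 4 → ℝ} (ha : StrictMono a) {s : ℝ} (h : nodal a s ≠ 0) :
    HasDerivAt (bigOmega a) (1 / omega a s) s := by
  refine intervalIntegral.integral_hasDerivAt_right (intervalIntegrable_inv_omega ha _ _) ?_ ?_
  · exact (measurable_const.div
      (continuous_omega a).measurable).stronglyMeasurable.stronglyMeasurableAtFilter
  · exact continuousAt_const.div (continuous_omega a).continuousAt (omega_pos h).ne'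

lemma strictMonoOn_bigOmega_of_nodal {a : Fin 4 → ℝ} (ha : StrictMono a) {l u : ℝ}
    (h : ∀ s ∈ Ioo l u, nodal a s ≠ 0) : StrictMonoOn (bigOmega a) (Icc l u) := by
  refine strictMonoOn_of_deriv_pos (convex_Icc l u) (continuous_bigOmega ha).continuousOn ?_
  intro s hs
  rw [interior_Icc] at hs
  rw [(hasDerivAt_bigOmega ha (h s hs)).deriv]
  exact one_div_pos.2 (omega_pos (h s hs))

lemma nodal_ne_zero_of_mem {a : Fin 4 → ℝ} (ha : StrictMono a) {i : Fin 3} {s : ℝ}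
    (hs : s ∈ Ioo (a i.castSucc) (a i.succ)) : nodal a s ≠ 0 := by
  rw [nodal_ne_zero_iff]
  rintro j rfl
  have h1 := ha.lt_iff_lt.1 hs.1
  have h2 := ha.lt_iff_lt.1 hs.2
  rw [Fin.lt_def] at h1 h2
  simp at h1 h2
  omega

lemma strictMonoOn_bigOmega {a : Fin 4 → ℝ} (ha : StrictMono a) :
    StrictMonoOn (bigOmega a) (Icc (a 0) (a 3)) := by
  have h01 : a 0 ≤ a 1 := ha.monotone (by decide)
  have h12 : a 1 ≤ a 2 := ha.monotone (by decide)
  have h23 : a 2 ≤ a 3 := ha.monotone (by decide)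
  have m : ∀ i : Fin 3, StrictMonoOn (bigOmega a) (Icc (a i.castSucc) (a i.succ)) := fun i =>
    strictMonoOn_bigOmega_of_nodal ha fun s hs => nodal_ne_zero_of_mem ha hs
  have m0 : StrictMonoOn (bigOmega a) (Icc (a 0) (a 1)) := m 0
  have m1 : StrictMonoOn (bigOmega a) (Icc (a 1) (a 2)) := m 1
  have m2 : StrictMonoOn (bigOmega a) (Icc (a 2) (a 3)) := m 2
  have u1 := m0.union m1 (isGreatest_Icc h01) (isLeast_Icc h12)
  rw [Icc_union_Icc_eq_Icc h01 h12] at u1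
  have u2 := u1.union m2 (isGreatest_Icc (h01.trans h12)) (isLeast_Icc h23)
  rwa [Icc_union_Icc_eq_Icc (h01.trans h12) h23] at u2

lemma phi_bigOmega {a : Fin 4 → ℝ} (ha : StrictMono a) {s : ℝ} (hs : s ∈ Icc (a 0) (a 3)) :
    phi a (bigOmega a s) = s :=
  (strictMonoOn_bigOmega ha).injOn.leftInvOn_invFunOn hs

end EllipticIntegral

/-! ### The separated equations as first order systems in s -/

section RadialSystem

/-- `E' = V / ω` and `V' = q E / ω` in the interior of `[α, β]`, with `E`, `V` continuous. -/
structure IsRadial (ω q E V : ℝ → ℝ) (α β : ℝ) : Prop where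
  derivE : ∀ s ∈ Ioo α β, HasDerivAt E (V s / ω s) s
  derivV : ∀ s ∈ Ioo α β, HasDerivAt V (q s * E s / ω s) s
  contE : ContinuousOn E (Icc α β)
  contV : ContinuousOn V (Icc α β)

/-- Under t = Ω(s) one has d/dt = ω d/ds. Keeping V = du/dt as second unknown, instead of dE/ds,
gives continuity up to the singular end points, where the boundary conditions are read off. -/
lemma isRadial_of_solves {a : Fin 4 → ℝ} (ha : StrictMono a) (i : Fin 3) {k q u : ℝ → ℝ}
    (hu : Solves k u (b a i.castSucc) (b a i.succ))
    (hk : ∀ s ∈ Ioo (a i.castSucc) (a i.succ), k (bigOmega a s) = -q s) :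
    IsRadial (omega a) q (fun s => u (bigOmega a s))
      (fun s => derivWithin u (Icc (b a i.castSucc) (b a i.succ)) (bigOmega a s))
      (a i.castSucc) (a i.succ) := by
  have hle : a i.castSucc ≤ a i.succ := ha.monotone (Fin.castSucc_lt_succ).le
  have hm : StrictMonoOn (bigOmega a) (Icc (a i.castSucc) (a i.succ)) :=
    strictMonoOn_bigOmega_of_nodal ha fun s hs => nodal_ne_zero_of_mem ha hs
  have hmaps : MapsTo (bigOmega a) (Icc (a i.castSucc) (a i.succ))
      (Icc (b a i.castSucc) (b a i.succ)) := fun s hs =>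
    ⟨hm.monotoneOn (left_mem_Icc.2 hle) hs hs.1, hm.monotoneOn hs (right_mem_Icc.2 hle) hs.2⟩
  have hmem : ∀ s ∈ Ioo (a i.castSucc) (a i.succ),
      Icc (b a i.castSucc) (b a i.succ) ∈ 𝓝 (bigOmega a s) := fun s hs =>
    Icc_mem_nhds (hm (left_mem_Icc.2 hle) (Ioo_subset_Icc_self hs) hs.1)
      (hm (Ioo_subset_Icc_self hs) (right_mem_Icc.2 hle) hs.2)
  have hc := (continuous_bigOmega ha).continuousOn (s := Icc (a i.castSucc) (a i.succ))
  obtain ⟨hd, hd2⟩ := hu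
  refine ⟨fun s hs => ?_, fun s hs => ?_, ?_, ?_⟩
  · have h1 : HasDerivAt u (derivWithin u (Icc (b a i.castSucc) (b a i.succ)) (bigOmega a s))
        (bigOmega a s) :=
      ((hd _ (hmaps (Ioo_subset_Icc_self hs))).hasDerivWithinAt).hasDerivAt (hmem s hs)
    exact (h1.comp s (hasDerivAt_bigOmega ha (nodal_ne_zero_of_mem ha hs))).congr_deriv (by ring)
  · have h1 := (hd2 _ (hmaps (Ioo_subset_Icc_self hs))).hasDerivAt (hmem s hs)
    refine (h1.comp s (hasDerivAt_bigOmega ha (nodal_ne_zero_of_mem ha hs))).congr_deriv ?_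
    rw [hk s hs]
    ring
  · exact hd.continuousOn.comp hc hmaps
  · exact ContinuousOn.comp (fun t ht => (hd2 t ht).continuousWithinAt) hc hmaps

/-- Two solutions of the same first order system whose Wronskian tends to zero are
proportional. -/
lemma exists_eq_const_mul {J : Set ℝ} (hJ : IsOpen J) (hJc : IsPreconnected J)
    {ω q E V w z : ℝ → ℝ}
    (hE : ∀ s ∈ J, HasDerivAt E (V s / ω s) s) (hV : ∀ s ∈ J, HasDerivAt V (q s * E s / ω s) s)
    (hw : ∀ s ∈ J, HasDerivAt w (z s / ω s) s) (hz : ∀ s ∈ J, HasDerivAt z (q s * w s / ω s) s)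
    (hw0 : ∀ s ∈ J, w s ≠ 0) {A : ℝ} [NeBot (𝓝[J] A)]
    (hlim : Tendsto (fun s => E s * z s - V s * w s) (𝓝[J] A) (𝓝 0)) :
    ∃ c, ∀ s ∈ J, E s = c * w s := by
  -- The system has trace zero, so the Wronskian is constant. Once it is zero, the quotient E/w has
  -- derivative zero.
  have hW : ∀ s ∈ J, HasDerivAt (fun s => E s * z s - V s * w s) 0 s := fun s hs =>
    (((hE s hs).mul (hz s hs)).sub ((hV s hs).mul (hw s hs))).congr_deriv (by ring)
  obtain ⟨d, hd⟩ := hJ.exists_is_const_of_deriv_eq_zero hJc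
    (fun s hs => (hW s hs).differentiableAt.differentiableWithinAt) (fun s hs => (hW s hs).deriv)
  have hd0 : d = 0 := by
    refine tendsto_nhds_unique (tendsto_const_nhds.congr' ?_) hlim
    filter_upwards [self_mem_nhdsWithin] with s hs using (hd s hs).symm
  have hQ : ∀ s ∈ J, HasDerivAt (fun s => E s / w s) 0 s := fun s hs => by
    refine ((hE s hs).div (hw s hs) (hw0 s hs)).congr_deriv ?_
    have h := hd s hs
    rw [hd0] at h
    have : V s / ω s * w s - E s * (z s / ω s) = 0 := by linear_combination -(1 / ω s) * h
    rw [this, zero_div]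
  obtain ⟨c, hc⟩ := hJ.exists_is_const_of_deriv_eq_zero hJc
    (fun s hs => (hQ s hs).differentiableAt.differentiableWithinAt) (fun s hs => (hQ s hs).deriv)
  exact ⟨c, fun s hs => by rw [← hc s hs, div_mul_cancel₀ _ (hw0 s hs)]⟩

end RadialSystem

/-! ### Boundary conditions select Frobenius solutions -/

section LocalFactor

lemma hasDerivAt_sqrt_abs {N : ℝ → ℝ} {N' s : ℝ} (h : HasDerivAt N N' s) (h0 : N s ≠ 0) :
    HasDerivAt (fun s => √|N s|) (√|N s| * N' / (2 * N s)) s := by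
  have hc := h.continuousAt
  rcases h0.lt_or_gt with h1 | h1
  · have e : (fun s => √|N s|) =ᶠ[𝓝 s] fun s => √(-N s) := by
      filter_upwards [hc.eventually_lt continuousAt_const h1] with t ht
      rw [abs_of_neg ht]
    refine ((h.neg.sqrt (by simpa using h0)).congr_of_eventuallyEq e).congr_deriv ?_
    have hp : 0 < √(-N s) := Real.sqrt_pos.2 (by linarith)
    have hsq : √(-N s) * √(-N s) = -N s := Real.mul_self_sqrt (by linarith)
    rw [abs_of_neg h1, Pi.neg_apply, div_eq_div_iff (by positivity) (by simpa using h0)]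
    linear_combination (-2 * N') * hsq
  · have e : (fun s => √|N s|) =ᶠ[𝓝 s] fun s => √(N s) := by
      filter_upwards [continuousAt_const.eventually_lt hc h1] with t ht
      rw [abs_of_pos ht]
    refine ((h.sqrt h0).congr_of_eventuallyEq e).congr_deriv ?_
    have hp : 0 < √(N s) := Real.sqrt_pos.2 h1
    have hsq : √(N s) * √(N s) = N s := Real.mul_self_sqrt h1.le
    rw [abs_of_pos h1, div_eq_div_iff (by positivity) (by simpa using h0)]
    linear_combination (-2 * N') * hsq

lemma analyticAt_sqrt_abs {x : ℝ} (hx : x ≠ 0) : AnalyticAt ℝ (fun x => √|x|) x := by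
  have h1 : AnalyticAt ℝ (fun x : ℝ => Real.exp (Real.log (x ^ 2) / 4)) x := by
    have h2 : AnalyticAt ℝ (fun x : ℝ => x ^ 2) x := analyticAt_id.pow 2
    have h3 : AnalyticAt ℝ (fun x : ℝ => Real.log (x ^ 2)) x :=
      AnalyticAt.log h2 (by positivity)
    exact (h3.div_const (c := 4)).rexp'
  refine h1.congr ?_
  filter_upwards [isOpen_ne.mem_nhds hx] with y hy
  have hy : y ≠ 0 := hy
  have h4 : 0 < |y| := abs_pos.2 hy
  rw [← sq_abs, Real.log_pow, Real.sqrt_eq_rpow, Real.rpow_def_of_pos h4]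
  congr 1
  push_cast
  ring

lemma exists_cofactor_taylor (a : Fin 4 → ℝ) (j : Fin 4) : ∃ c₁ c₂ c₃ : ℝ, ∀ s,
    cofactor a j s = cofactor a j (a j) + c₁ * (s - a j) + c₂ * (s - a j) ^ 2 +
      c₃ * (s - a j) ^ 3 := by
  have key : ∀ A d₁ d₂ d₃ : ℝ, ∃ c₁ c₂ c₃ : ℝ, ∀ s,
      (s - d₁) * (s - d₂) * (s - d₃) = (A - d₁) * (A - d₂) * (A - d₃) + c₁ * (s - A) +
        c₂ * (s - A) ^ 2 + c₃ * (s - A) ^ 3 := fun A d₁ d₂ d₃ =>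
    ⟨(A - d₁) * (A - d₂) + (A - d₁) * (A - d₃) + (A - d₂) * (A - d₃),
      (A - d₁) + (A - d₂) + (A - d₃), 1, fun s => by ring⟩
  exact match j with
  | 0 => by simpa only [cofactor_zero] using key (a 0) (a 1) (a 2) (a 3)
  | 1 => by simpa only [cofactor_one] using key (a 1) (a 0) (a 2) (a 3)
  | 2 => by simpa only [cofactor_two] using key (a 2) (a 0) (a 1) (a 3)
  | 3 => by simpa only [cofactor_three] using key (a 3) (a 0) (a 1) (a 2)

lemma differentiable_cofactor (a : Fin 4 → ℝ) (j : Fin 4) : Differentiable ℝ (cofactor a j) := by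
  unfold cofactor; fun_prop

/-- For e = 0 and e = 1 this is the equation for g when E = |s - a_j|^(e/2) g solves P E'' + P' E'/2
+ Q E = 0. The substitution moves the exponent e/2 to 0, where Frobenius' theorem applies without
resonance. -/
lemma exists_local_solution {a : Fin 4 → ℝ} (ha : StrictMono a) (l₁ l₂ : ℝ) (j : Fin 4) (e : ℝ)
    (he : 0 ≤ e) : ∃ g : ℝ → ℝ, AnalyticAt ℝ g (a j) ∧ g (a j) = 1 ∧ ∀ᶠ s in 𝓝 (a j),
      (s - a j) * cofactor a j s * deriv (deriv g) s +
        ((1 / 2 + e) * cofactor a j s + 1 / 2 * (s - a j) * deriv (cofactor a j) s) * deriv g s +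
        (e / 4 * deriv (cofactor a j) s + vanVleck l₁ l₂ s) * g s = 0 := by
  obtain ⟨c₁, c₂, c₃, hc⟩ := exists_cofactor_taylor a j
  set A := a j with hA
  set c₀ := cofactor a j A with hc0
  have hd : ∀ s, deriv (cofactor a j) s = c₁ + 2 * c₂ * (s - A) + 3 * c₃ * (s - A) ^ 2 := by
    intro s
    have e1 : cofactor a j = fun s => c₀ + c₁ * (s - A) + c₂ * (s - A) ^ 2 + c₃ * (s - A) ^ 3 :=
      funext hc
    have h1 := (hasDerivAt_id s).sub_const A
    have h2 : HasDerivAt (fun s => c₀ + c₁ * (s - A) + c₂ * (s - A) ^ 2 + c₃ * (s - A) ^ 3)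
        (c₁ + 2 * c₂ * (s - A) + 3 * c₃ * (s - A) ^ 2) s := by
      refine ((((h1.const_mul c₁).const_add c₀).add ((h1.pow 2).const_mul c₂)).add
        ((h1.pow 3).const_mul c₃)).congr_deriv ?_
      simp
      ring
    rw [e1, h2.deriv]
  obtain ⟨g, hg, hg0, hode⟩ := exists_analytic_solution c₀ c₁ c₂ c₃
    (e / 4 * c₁ + (3 / 16 * A ^ 2 + l₁ * A + l₂)) (e / 4 * (2 * c₂) + (3 / 8 * A + l₁))
    (e / 4 * (3 * c₃) + 3 / 16) e (cofactor_self_ne_zero ha j) he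
  have hd1 : ∀ f : ℝ → ℝ, deriv (fun s => f (s - A)) = fun s => deriv f (s - A) := fun f => by
    funext s
    exact deriv_comp_sub_const f A s
  refine ⟨fun s => g (s - A), ?_, by simp [hg0], ?_⟩
  · have hg' : AnalyticAt ℝ g (A - A) := by rwa [sub_self]
    exact hg'.fun_comp (f := fun s => s - A) (analyticAt_id.sub analyticAt_const)
  · have ht : Tendsto (fun s => s - A) (𝓝 A) (𝓝 0) := by
      have : Continuous fun s => s - A := by fun_prop
      simpa using this.tendsto A
    filter_upwards [ht.eventually hode] with s hs
    rw [hd1, hd1, hd, hc s]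
    rw [vanVleck]
    linear_combination hs

/-- A second order equation in the variable `s` as a first order system. -/
lemma hasDerivAt_omega_mul {a : Fin 4 → ℝ} {s κ Q N' w w₂ : ℝ} {w₁ : ℝ → ℝ}
    (hN : HasDerivAt (nodal a) N' s)
    (h0 : nodal a s ≠ 0) (hs : |nodal a s| = -κ * nodal a s)
    (h1 : HasDerivAt w₁ w₂ s)
    (hode : nodal a s * w₂ + 1 / 2 * N' * w₁ s + Q * w = 0) :
    HasDerivAt (fun s => omega a s * w₁ s) (κ * Q * w / omega a s) s := by
  have hω : HasDerivAt (omega a) (omega a s * N' / (2 * nodal a s)) s :=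
    hasDerivAt_sqrt_abs hN h0
  have hp := omega_pos h0
  have hsq : omega a s * omega a s = -κ * nodal a s := by
    rw [omega_def, Real.mul_self_sqrt (abs_nonneg _), hs]
  refine (hω.mul h1).congr_deriv ?_
  rw [eq_div_iff hp.ne']
  field_simp
  linear_combination (N' * w₁ s + 2 * nodal a s * w₂) * hsq - 2 * κ * nodal a s * hode

lemma hasDerivAt_nodal (a : Fin 4 → ℝ) (j : Fin 4) (s : ℝ) :
    HasDerivAt (nodal a) (cofactor a j s + (s - a j) * deriv (cofactor a j) s) s := by
  have e : nodal a = fun s => (s - a j) * cofactor a j s := funext (nodal_eq a j)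
  rw [e]
  exact (((hasDerivAt_id s).sub_const (a j)).mul
    (differentiable_cofactor a j s).hasDerivAt).congr_deriv (by simp)

lemma tendsto_of_subset_Icc {E : ℝ → ℝ} {α β A : ℝ} {J : Set ℝ} (h : ContinuousOn E (Icc α β))
    (hA : A ∈ Icc α β) (hJ : J ⊆ Icc α β) : Tendsto E (𝓝[J] A) (𝓝 (E A)) :=
  (h A hA).mono_left (nhdsWithin_mono _ hJ)

/-- On an interval with end point `a_j` a solution satisfying the boundary condition is a multiple
of the Frobenius solution. -/
lemma exists_eq_const_mul_frobenius {a : Fin 4 → ℝ} {l₁ l₂ : ℝ} {j : Fin 4} {e : Fin 2}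
    {g : ℝ → ℝ} (hg : AnalyticAt ℝ g (a j)) {J : Set ℝ} (hJ : IsOpen J) (hJc : IsPreconnected J)
    [NeBot (𝓝[J] (a j))] {α β κ : ℝ} (hJ1 : J ⊆ Ioo α β) (hA : a j ∈ Icc α β)
    (hgJ : ∀ s ∈ J, AnalyticAt ℝ g s ∧ g s ≠ 0 ∧ nodal a s ≠ 0 ∧ |nodal a s| = -κ * nodal a s)
    (hode : ∀ s ∈ J, (s - a j) * cofactor a j s * deriv (deriv g) s +
        ((1 / 2 + (e : ℕ)) * cofactor a j s + 1 / 2 * (s - a j) * deriv (cofactor a j) s) *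
          deriv g s +
        ((e : ℕ) / 4 * deriv (cofactor a j) s + vanVleck l₁ l₂ s) * g s = 0)
    {E V : ℝ → ℝ} (hEV : IsRadial (omega a) (fun s => κ * vanVleck l₁ l₂ s) E V α β)
    (hb0 : e = 0 → V (a j) = 0) (hb1 : e = 1 → E (a j) = 0) :
    ∃ c, ∀ s ∈ insert (a j) J, E s = c * (√|s - a j| ^ (e : ℕ) * g s) := by
  set A := a j with hAdef
  have hJ2 : J ⊆ Icc α β := hJ1.trans Ioo_subset_Icc_self
  have tE := tendsto_of_subset_Icc hEV.contE hA hJ2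
  have tV := tendsto_of_subset_Icc hEV.contV hA hJ2
  have tg : Tendsto g (𝓝[J] A) (𝓝 (g A)) := hg.continuousAt.mono_left nhdsWithin_le_nhds
  have tg' : Tendsto (deriv g) (𝓝[J] A) (𝓝 (deriv g A)) :=
    hg.deriv.continuousAt.mono_left nhdsWithin_le_nhds
  have hm : Continuous fun s => √|s - A| := by fun_prop
  have tm : Tendsto (fun s => √|s - A|) (𝓝[J] A) (𝓝 0) := by
    have := (hm.tendsto A).mono_left (nhdsWithin_le_nhds (s := J))
    simpa using this
  have tω : Tendsto (omega a) (𝓝[J] A) (𝓝 0) := by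
    have := ((continuous_omega a).tendsto A).mono_left (nhdsWithin_le_nhds (s := J))
    rwa [omega_def, nodal_eq a j, hAdef, sub_self, zero_mul, abs_zero, Real.sqrt_zero] at this
  suffices h : ∃ c, ∀ s ∈ J, E s = c * (√|s - A| ^ (e : ℕ) * g s) by
    obtain ⟨c, hc⟩ := h
    refine ⟨c, fun s hs => ?_⟩
    rcases hs with rfl | hs
    · have t1 : Tendsto (fun s => c * (√|s - A| ^ (e : ℕ) * g s)) (𝓝[J] A)
          (𝓝 (c * (√|A - A| ^ (e : ℕ) * g A))) :=
        ((((hm.pow _).tendsto A).mono_left nhdsWithin_le_nhds).mul tg).const_mul c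
      refine tendsto_nhds_unique tE (t1.congr' ?_)
      filter_upwards [self_mem_nhdsWithin] with s hs using (hc s hs).symm
    · exact hc s hs
  have hE : ∀ s ∈ J, HasDerivAt E (V s / omega a s) s := fun s hs => hEV.derivE s (hJ1 hs)
  have hV : ∀ s ∈ J, HasDerivAt V (κ * vanVleck l₁ l₂ s * E s / omega a s) s :=
    fun s hs => hEV.derivV s (hJ1 hs)
  have hsA : ∀ s ∈ J, s - A ≠ 0 := fun s hs h => by
    refine (hgJ s hs).2.2.1 ?_
    rw [nodal_eq a j, ← hAdef, h, zero_mul]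
  have hg1 : ∀ s ∈ J, HasDerivAt g (deriv g s) s := fun s hs =>
    (hgJ s hs).1.differentiableAt.hasDerivAt
  have hg2 : ∀ s ∈ J, HasDerivAt (deriv g) (deriv (deriv g) s) s := fun s hs =>
    (hgJ s hs).1.deriv.differentiableAt.hasDerivAt
  have hωJ : ∀ s ∈ J, omega a s ≠ 0 := fun s hs => (omega_pos (hgJ s hs).2.2.1).ne'
  obtain rfl | rfl : e = 0 ∨ e = 1 := by omega
  · simp only [Fin.val_zero, pow_zero, one_mul, Nat.cast_zero, add_zero, zero_div]
      at hode ⊢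
    refine exists_eq_const_mul hJ hJc hE hV (z := fun s => omega a s * deriv g s) (A := A)
      (fun s hs => (hg1 s hs).congr_deriv ?_) (fun s hs => ?_) (fun s hs => (hgJ s hs).2.1) ?_
    · rw [mul_div_cancel_left₀ _ (hωJ s hs)]
    · refine hasDerivAt_omega_mul (hasDerivAt_nodal a j s) (hgJ s hs).2.2.1 (hgJ s hs).2.2.2
        (hg2 s hs) ?_
      rw [nodal_eq a j]
      linear_combination hode s hs
    -- In the Wronskian E ω g' - V g the first term dies with ω, the second by the Neumann condition
    -- V(a_j) = 0.
    · have := (tE.mul (tω.mul tg')).sub (tV.mul tg)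
      rw [hb0 rfl] at this
      simpa using this
  · simp only [Fin.val_one, pow_one, Nat.cast_one] at hode ⊢
    have hmd : ∀ s ∈ J, HasDerivAt (fun s => √|s - A|) (√|s - A| * 1 / (2 * (s - A))) s :=
      fun s hs => hasDerivAt_sqrt_abs ((hasDerivAt_id s).sub_const A) (hsA s hs)
    have hw1 : ∀ s ∈ J, HasDerivAt (fun s => √|s - A| * g s)
        (√|s - A| * (deriv g s + g s / (2 * (s - A)))) s := fun s hs => by
      refine ((hmd s hs).mul (hg1 s hs)).congr_deriv ?_
      have := hsA s hs
      field_simp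
      ring
    have hw2 : ∀ s ∈ J, HasDerivAt (fun s => √|s - A| * (deriv g s + g s / (2 * (s - A))))
        (√|s - A| * (deriv (deriv g) s + deriv g s / (s - A) - g s / (4 * (s - A) ^ 2))) s := by
      intro s hs
      have h0 := hsA s hs
      refine ((hmd s hs).mul ((hg2 s hs).add ((hg1 s hs).div
        (((hasDerivAt_id s).sub_const A).const_mul 2) (by simpa using h0)))).congr_deriv ?_
      simp only [id, Pi.add_apply, Pi.div_apply]
      field_simp
      ring
    refine exists_eq_const_mul hJ hJc hE hV
      (z := fun s => omega a s * (√|s - A| * (deriv g s + g s / (2 * (s - A))))) (A := A)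
      (fun s hs => (hw1 s hs).congr_deriv ?_) (fun s hs => ?_)
      (fun s hs => mul_ne_zero (Real.sqrt_pos.2 (abs_pos.2 (hsA s hs))).ne' (hgJ s hs).2.1) ?_
    · rw [mul_div_cancel_left₀ _ (hωJ s hs)]
    · refine hasDerivAt_omega_mul (hasDerivAt_nodal a j s) (hgJ s hs).2.2.1 (hgJ s hs).2.2.2
        (hw2 s hs) ?_
      have h0 := hsA s hs
      rw [nodal_eq a j, ← hAdef]
      have h1 := hode s hs
      have hi := mul_inv_cancel₀ h0
      generalize s - A = x at h1 hi ⊢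
      linear_combination √|x| * h1 + √|x| * (cofactor a j s * deriv g s -
        cofactor a j s * g s * x⁻¹ / 4 + deriv (cofactor a j) s * g s / 4) * hi
    · rw [hb1 rfl] at tE
      have tC : Tendsto (fun s => √|cofactor a j s|) (𝓝[J] A) (𝓝 (√|cofactor a j A|)) :=
        ((continuous_cofactor a j).abs.sqrt.tendsto A).mono_left nhdsWithin_le_nhds
      have t1 : Tendsto (fun s => E s * omega a s * √|s - A| * deriv g s) (𝓝[J] A) (𝓝 0) := by
        simpa using ((tE.mul tω).mul tm).mul tg'
      have t2 : Tendsto (fun s => E s * √|cofactor a j s| * g s / 2) (𝓝[J] A) (𝓝 0) := by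
        simpa using ((tE.mul tC).mul tg).div_const 2
      -- The derivative of √|s - A| is singular, but ω √|s - A| = |s - A| √|C| compensates: what is
      -- left is a bounded sign times E, and E tends to 0 by the Dirichlet condition.
      have t3 : Tendsto (fun s => |s - A| / (s - A) * (E s * √|cofactor a j s| * g s / 2))
          (𝓝[J] A) (𝓝 0) := by
        refine bdd_le_mul_tendsto_zero' 1 (Eventually.of_forall fun s => ?_) t2
        rw [abs_div, abs_abs]
        exact div_self_le_one _
      have t4 : Tendsto (fun s => V s * (√|s - A| * g s)) (𝓝[J] A) (𝓝 0) := by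
        simpa using tV.mul (tm.mul tg)
      have := (t1.add t3).sub t4
      simp only [add_zero, sub_zero] at this
      refine this.congr' ?_
      filter_upwards [self_mem_nhdsWithin] with s hs
      have h0 := hsA s hs
      have e1 : omega a s * √|s - A| = |s - A| * √|cofactor a j s| := by
        rw [omega_def, nodal_eq a j, ← hAdef, abs_mul, Real.sqrt_mul (abs_nonneg _),
          mul_right_comm, Real.mul_self_sqrt (abs_nonneg _)]
      have e2 : E s * (omega a s * (√|s - A| * (deriv g s + g s / (2 * (s - A))))) =
          E s * (omega a s * √|s - A|) * deriv g s +
          E s * (omega a s * √|s - A|) * (g s / (2 * (s - A))) := by ring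
      rw [e2, e1]
      have e3 : E s * omega a s * √|s - A| * deriv g s =
          E s * (omega a s * √|s - A|) * deriv g s := by ring
      rw [e3, e1]
      field_simp

end LocalFactor

/-! ### Factoring the solutions as envelope times smooth function -/

section Envelope

/-- The sign of the potential on the `i`-th interval. -/
def orient (i : Fin 3) : ℝ := ![1, -1, 1] i

lemma orient_sq (i : Fin 3) : orient i ^ 2 = 1 := by
  fin_cases i <;> simp [orient]

lemma abs_nodal {a : Fin 4 → ℝ} (ha : StrictMono a) {i : Fin 3} {s : ℝ}
    (hs : s ∈ Ioo (a i.castSucc) (a i.succ)) : |nodal a s| = -orient i * nodal a s := by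
  have h01 : a 0 < a 1 := ha (by decide)
  have h12 : a 1 < a 2 := ha (by decide)
  have h23 : a 2 < a 3 := ha (by decide)
  rw [nodal_eq a 0, cofactor_zero]
  match i, hs with
  | 0, hs =>
    have hs : s ∈ Ioo (a 0) (a 1) := hs
    have p0 := sub_pos.2 hs.1
    have p1 := sub_neg.2 hs.2
    have p2 := sub_neg.2 (hs.2.trans h12)
    have p3 := sub_neg.2 ((hs.2.trans h12).trans h23)
    rw [abs_of_neg (mul_neg_of_pos_of_neg p0 (mul_neg_of_pos_of_neg
      (mul_pos_of_neg_of_neg p1 p2) p3))]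
    simp [orient]
  | 1, hs =>
    have hs : s ∈ Ioo (a 1) (a 2) := hs
    have p0 := sub_pos.2 (h01.trans hs.1)
    have p1 := sub_pos.2 hs.1
    have p2 := sub_neg.2 hs.2
    have p3 := sub_neg.2 (hs.2.trans h23)
    rw [abs_of_pos (mul_pos p0 (mul_pos_of_neg_of_neg (mul_neg_of_pos_of_neg p1 p2) p3))]
    simp [orient]
  | 2, hs =>
    have hs : s ∈ Ioo (a 2) (a 3) := hs
    have p0 := sub_pos.2 ((h01.trans h12).trans hs.1)
    have p1 := sub_pos.2 (h12.trans hs.1)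
    have p2 := sub_pos.2 hs.1
    have p3 := sub_neg.2 hs.2
    rw [abs_of_neg (mul_neg_of_pos_of_neg p0 (mul_neg_of_pos_of_neg (mul_pos p1 p2) p3))]
    simp [orient]

/-- The function `∏_j |s - a_j|^{p_j / 2}`, `j = 1, 2, 3`. -/
def envelope (a : Fin 4 → ℝ) (p : Fin 3 → Fin 2) (s : ℝ) : ℝ :=
  ∏ j : Fin 3, √|s - a j.succ| ^ (p j : ℕ)

lemma analyticAt_sqrt_abs_sub_pow {c s : ℝ} (h : s ≠ c) (n : ℕ) :
    AnalyticAt ℝ (fun s => √|s - c| ^ n) s := by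
  have h1 : AnalyticAt ℝ (fun s => s - c) s := analyticAt_id.sub analyticAt_const
  have h2 : AnalyticAt ℝ (fun s => √|s - c|) s :=
    AnalyticAt.fun_comp (f := fun s => s - c) (g := fun x => √|x|)
      (analyticAt_sqrt_abs (sub_ne_zero.2 h)) h1
  exact h2.pow n

lemma sqrt_abs_sub_pow_ne_zero {c s : ℝ} (h : s ≠ c) (n : ℕ) : √|s - c| ^ n ≠ 0 :=
  pow_ne_zero _ (Real.sqrt_pos.2 (abs_pos.2 (sub_ne_zero.2 h))).ne'

/-- `E` and `V` solve the radial system on each of the three intervals, with the boundary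
conditions given by `p`. -/
structure IsRadialTriple (a : Fin 4 → ℝ) (p : Fin 3 → Fin 2) (l₁ l₂ : ℝ)
    (E V : Fin 3 → ℝ → ℝ) : Prop where
  radial : ∀ i, IsRadial (omega a) (fun s => orient i * vanVleck l₁ l₂ s) (E i) (V i)
    (a i.castSucc) (a i.succ)
  even : ∀ i j : Fin 3, (j.succ = i.castSucc ∨ j.succ = i.succ) → p j = 0 → V i (a j.succ) = 0
  odd : ∀ i j : Fin 3, (j.succ = i.castSucc ∨ j.succ = i.succ) → p j = 1 → E i (a j.succ) = 0

variable {a : Fin 4 → ℝ} {p : Fin 3 → Fin 2} {l₁ l₂ : ℝ} {E V : Fin 3 → ℝ → ℝ}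

/-- Near `a_j` the solutions on both sides are multiples of the same analytic function times the
envelope. -/
theorem exists_local_factor (ha : StrictMono a) (h : IsRadialTriple a p l₁ l₂ E V) (j : Fin 3) :
    ∃ g : ℝ → ℝ, AnalyticAt ℝ g (a j.succ) ∧
      ∀ i : Fin 3, (j.succ = i.castSucc ∨ j.succ = i.succ) →
        ∃ c, ∀ᶠ s in 𝓝 (a j.succ), s ∈ Icc (a i.castSucc) (a i.succ) →
          E i s = envelope a p s * (c * g s) := by
  obtain ⟨g, hg, hg1, hode⟩ := exists_local_solution ha l₁ l₂ j.succ ((p j : ℕ) : ℝ) (by positivity)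
  set A := a j.succ with hA
  set r : ℝ → ℝ := fun s => ∏ k ∈ Finset.univ.erase j, √|s - a k.succ| ^ (p k : ℕ) with hr
  have hne : ∀ k ∈ Finset.univ.erase j, A ≠ a k.succ := fun k hk hAk =>
    Finset.ne_of_mem_erase hk (Fin.succ_injective _ (ha.injective hAk)).symm
  have hra : AnalyticAt ℝ r A := Finset.analyticAt_fun_prod _ fun k hk =>
    analyticAt_sqrt_abs_sub_pow (hne k hk) _
  have hr0 : r A ≠ 0 := Finset.prod_ne_zero_iff.2 fun k hk =>
    sqrt_abs_sub_pow_ne_zero (hne k hk) _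
  have henv : ∀ s, envelope a p s = √|s - A| ^ (p j : ℕ) * r s := fun s => by
    rw [envelope, hr, ← Finset.mul_prod_erase _ _ (Finset.mem_univ j)]
  -- The other factors r of the envelope are analytic and nonzero at a_j; dividing by them allows
  -- the full envelope to be used at every node. The function g does not depend on i, only the
  -- constant does.
  refine ⟨fun s => g s / r s, hg.fun_div hra hr0, fun i hi => ?_⟩
  have hev : ∀ᶠ s in 𝓝 A, ((s - A) * cofactor a j.succ s * deriv (deriv g) s +
        ((1 / 2 + ((p j : ℕ) : ℝ)) * cofactor a j.succ s +
          1 / 2 * (s - A) * deriv (cofactor a j.succ) s) * deriv g s +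
        (((p j : ℕ) : ℝ) / 4 * deriv (cofactor a j.succ) s + vanVleck l₁ l₂ s) * g s = 0) ∧
      AnalyticAt ℝ g s ∧ g s ≠ 0 ∧ r s ≠ 0 := by
    filter_upwards [hode, hg.eventually_analyticAt,
      hg.continuousAt.eventually_ne (by rw [hg1]; exact one_ne_zero),
      hra.continuousAt.eventually_ne hr0] with s h1 h2 h3 h4 using ⟨h1, h2, h3, h4⟩
  obtain ⟨l, u, hlu, hsub⟩ := mem_nhds_iff_exists_Ioo_subset.1 hev
  have hlt : a i.castSucc < a i.succ := ha Fin.castSucc_lt_succ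
  -- J will be a one-sided punctured neighbourhood of A, to the right or to the left according to
  -- which end of the i-th interval A is.
  have main : ∀ J : Set ℝ, IsOpen J → IsPreconnected J → NeBot (𝓝[J] A) →
      J ⊆ Ioo (a i.castSucc) (a i.succ) → J ⊆ Ioo l u → A ∈ Icc (a i.castSucc) (a i.succ) →
      (∀ᶠ s in 𝓝 A, s ∈ Icc (a i.castSucc) (a i.succ) → s ∈ insert A J) →
      ∃ c, ∀ᶠ s in 𝓝 A, s ∈ Icc (a i.castSucc) (a i.succ) →
          E i s = envelope a p s * (c * (g s / r s)) := by
    intro J hJ hJc hJn hJ1 hJ2 hAm hJe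
    obtain ⟨c, hc⟩ := exists_eq_const_mul_frobenius hg hJ hJc hJ1 hAm
      (fun s hs => ⟨(hsub (hJ2 hs)).2.1, (hsub (hJ2 hs)).2.2.1,
        nodal_ne_zero_of_mem ha (hJ1 hs), abs_nodal ha (hJ1 hs)⟩)
      (fun s hs => (hsub (hJ2 hs)).1) (h.radial i) (h.even i j hi) (h.odd i j hi)
    refine ⟨c, ?_⟩
    filter_upwards [hJe, hev] with s hs hs2 hs3
    have hrs := hs2.2.2.2
    rw [hc s (hs hs3), henv, ← hA]
    field_simp
  rcases hi with hi | hi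
  · have e : a i.castSucc = A := by rw [hA, hi]
    rw [e] at main ⊢ hlt
    have hm : A < min u (a i.succ) := lt_min hlu.2 hlt
    refine main (Ioo A (min u (a i.succ))) isOpen_Ioo isPreconnected_Ioo
      (left_nhdsWithin_Ioo_neBot hm) (Ioo_subset_Ioo_right (min_le_right _ _))
      (Ioo_subset_Ioo hlu.1.le (min_le_left _ _)) (left_mem_Icc.2 hlt.le) ?_
    filter_upwards [Iio_mem_nhds hm] with s hs hs2
    rcases hs2.1.eq_or_lt with h1 | h1
    · exact Or.inl h1.symm
    · exact Or.inr ⟨h1, hs⟩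
  · have e : a i.succ = A := by rw [hA, hi]
    rw [e] at main ⊢ hlt
    have hm : max l (a i.castSucc) < A := max_lt hlu.1 hlt
    refine main (Ioo (max l (a i.castSucc)) A) isOpen_Ioo isPreconnected_Ioo
      (right_nhdsWithin_Ioo_neBot hm) (Ioo_subset_Ioo_left (le_max_right _ _))
      (Ioo_subset_Ioo (le_max_left _ _) hlu.2.le) (right_mem_Icc.2 hlt.le) ?_
    filter_upwards [Ioi_mem_nhds hm] with s hs hs2
    rcases hs2.2.eq_or_lt with h1 | h1
    · exact Or.inl h1
    · exact Or.inr ⟨hs, h1⟩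

lemma contDiffAt_omega {s : ℝ} (hs : nodal a s ≠ 0) {n : WithTop ℕ∞} :
    ContDiffAt ℝ n (omega a) s := by
  have h1 : ContDiffAt ℝ n (nodal a) s := by
    have : ContDiff ℝ n (nodal a) := by unfold nodal; fun_prop
    exact this.contDiffAt
  exact (analyticAt_sqrt_abs hs).contDiffAt.comp s h1

/-- Bootstrap through the system: E continuous makes V of class C¹, which makes E of class C². -/
lemma contDiffOn_radial (ha : StrictMono a) (h : IsRadialTriple a p l₁ l₂ E V) (i : Fin 3) :
    ContDiffOn ℝ 2 (E i) (Ioo (a i.castSucc) (a i.succ)) := by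
  set J := Ioo (a i.castSucc) (a i.succ)
  have hr := h.radial i
  have hω : ∀ n, ContDiffOn ℝ n (omega a) J := fun n s hs =>
    (contDiffAt_omega (nodal_ne_zero_of_mem ha hs)).contDiffWithinAt
  have hω0 : ∀ s ∈ J, omega a s ≠ 0 := fun s hs => (omega_pos (nodal_ne_zero_of_mem ha hs)).ne'
  have hE0 : ContDiffOn ℝ 0 (E i) J :=
    contDiffOn_zero.2 (hr.contE.mono Ioo_subset_Icc_self)
  have hq : ContDiffOn ℝ 0 (fun s => orient i * vanVleck l₁ l₂ s) J := by
    unfold vanVleck; fun_prop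
  have hV1 : ContDiffOn ℝ 1 (V i) J := by
    rw [show (1 : WithTop ℕ∞) = 0 + 1 by simp, contDiffOn_succ_iff_deriv_of_isOpen isOpen_Ioo]
    refine ⟨fun s hs => (hr.derivV s hs).differentiableAt.differentiableWithinAt, by simp, ?_⟩
    exact ((hq.mul hE0).div (hω 0) hω0).congr fun s hs => (hr.derivV s hs).deriv
  rw [show (2 : WithTop ℕ∞) = 1 + 1 by norm_num, contDiffOn_succ_iff_deriv_of_isOpen isOpen_Ioo]
  refine ⟨fun s hs => (hr.derivE s hs).differentiableAt.differentiableWithinAt, by simp, ?_⟩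
  exact (hV1.div (hω 1) hω0).congr fun s hs => (hr.derivE s hs).deriv

/-- The second order form `P E'' + P' E' / 2 + Q E = 0` of the radial equation. -/
lemma exists_deriv_radial (ha : StrictMono a) (h : IsRadialTriple a p l₁ l₂ E V) (i : Fin 3)
    {s : ℝ} (hs : s ∈ Ioo (a i.castSucc) (a i.succ)) {N' : ℝ} (hN : HasDerivAt (nodal a) N' s) :
    ∃ E₁ : ℝ → ℝ, ∃ E₂ : ℝ, (∀ᶠ t in 𝓝 s, HasDerivAt (E i) (E₁ t) t) ∧ HasDerivAt E₁ E₂ s ∧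
      nodal a s * E₂ + 1 / 2 * N' * E₁ s + vanVleck l₁ l₂ s * E i s = 0 := by
  have hr := h.radial i
  have h0 := nodal_ne_zero_of_mem ha hs
  have hp := omega_pos h0
  have hω : HasDerivAt (omega a) (omega a s * N' / (2 * nodal a s)) s :=
    hasDerivAt_sqrt_abs hN h0
  refine ⟨fun t => V i t / omega a t, _, ?_, (hr.derivV s hs).div hω hp.ne', ?_⟩
  · filter_upwards [isOpen_Ioo.mem_nhds hs] with t ht using hr.derivE t ht
  · have hsq : omega a s * omega a s = -orient i * nodal a s := by
      rw [omega_def, Real.mul_self_sqrt (abs_nonneg _), abs_nodal ha hs]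
    have hκ := orient_sq i
    have hn : nodal a s = -orient i * (omega a s * omega a s) := by
      rw [hsq]; linear_combination (-nodal a s) * hκ
    field_simp
    rw [hn]
    ring_nf
    rw [hκ]
    ring

/-- At a node the Frobenius factor serves; between nodes the envelope is analytic without zeros and
can be divided out. The node a₀ is excluded because no condition is imposed there. -/
lemma exists_smooth_factor (ha : StrictMono a) (h : IsRadialTriple a p l₁ l₂ E V) (i : Fin 3)
    {s : ℝ} (hs : s ∈ Icc (a i.castSucc) (a i.succ)) (hs0 : s ≠ a 0) :
    ∃ g : ℝ → ℝ, ContDiffAt ℝ 2 g s ∧ ∀ᶠ t in 𝓝 s, t ∈ Icc (a i.castSucc) (a i.succ) →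
      E i t = envelope a p t * g t := by
  by_cases hj : ∃ j : Fin 3, s = a j.succ
  · obtain ⟨j, rfl⟩ := hj
    have hij : j.succ = i.castSucc ∨ j.succ = i.succ := by
      have h1 := ha.le_iff_le.1 hs.1
      have h2 := ha.le_iff_le.1 hs.2
      rw [Fin.le_def] at h1 h2
      rw [Fin.ext_iff, Fin.ext_iff]
      simp at h1 h2 ⊢
      omega
    obtain ⟨g, hg, hgi⟩ := exists_local_factor ha h j
    obtain ⟨c, hc⟩ := hgi i hij
    exact ⟨fun t => c * g t, (analyticAt_const.mul hg).contDiffAt, hc⟩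
  · push Not at hj
    have hsI : s ∈ Ioo (a i.castSucc) (a i.succ) := by
      refine ⟨lt_of_le_of_ne hs.1 fun hh => ?_, lt_of_le_of_ne hs.2 (hj i)⟩
      induction i using Fin.cases with
      | zero => exact hs0 hh.symm
      | succ k => exact hj k.castSucc (by rw [← hh, Fin.succ_castSucc])
    have henv : ∀ᶠ t in 𝓝 s, envelope a p t ≠ 0 := by
      filter_upwards [isOpen_Ioo.mem_nhds hsI] with t ht
      exact Finset.prod_ne_zero_iff.2 fun k _ =>
        sqrt_abs_sub_pow_ne_zero (nodal_ne_zero_iff.1 (nodal_ne_zero_of_mem ha ht) _) _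
    have hea : AnalyticAt ℝ (envelope a p) s :=
      Finset.analyticAt_fun_prod _ fun k _ => analyticAt_sqrt_abs_sub_pow (hj k) _
    refine ⟨fun t => E i t / envelope a p t, ?_, ?_⟩
    · exact ((contDiffOn_radial ha h i).contDiffAt (isOpen_Ioo.mem_nhds hsI)).div hea.contDiffAt
        henv.self_of_nhds
    · filter_upwards [henv] with t ht _
      rw [mul_div_cancel₀ _ ht]

end Envelope

/-! ### G is C² on the ball and has parity p -/

section Regularity

variable {a : Fin 4 → ℝ} {p : Fin 3 → Fin 2} {l₁ l₂ : ℝ} {E V : Fin 3 → ℝ → ℝ}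

/-- Only one summand of the cubic survives at a_j. Consequently a coordinate can equal a_j only
where the j-th numerator vanishes. -/
lemma numer_mul_cofactor (ha : StrictMono a) (v : Space) (j : Fin 4) :
    numer v j * cofactor a j (a j) = conf v ^ 2 * ∏ i, (a j - coord a v i) := by
  rw [← weighted_numer ha, weighted_self]

lemma coord_ne_of_numer_ne_zero (ha : StrictMono a) {v : Space} {j : Fin 4} (h : numer v j ≠ 0)
    (i : Fin 3) : coord a v i ≠ a j := by
  intro hi
  have := numer_mul_cofactor ha v j
  rw [Finset.prod_eq_zero (Finset.mem_univ i) (by rw [hi, sub_self]), mul_zero] at this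
  exact mul_ne_zero h (cofactor_self_ne_zero ha j) this

lemma normSq_lt_one {v : Space} (hv : v ∈ Metric.ball (0 : Space) 1) :
    v 0 ^ 2 + v 1 ^ 2 + v 2 ^ 2 < 1 := by
  have h1 : ‖v‖ < 1 := by simpa using hv
  have h2 := EuclideanSpace.norm_sq_eq v
  rw [Fin.sum_univ_three] at h2
  simp only [Real.norm_eq_abs, sq_abs] at h2
  rw [← h2]
  nlinarith [norm_nonneg v]

lemma numer_zero_ne_zero {v : Space} (hv : v ∈ Metric.ball (0 : Space) 1) : numer v 0 ≠ 0 := by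
  have := normSq_lt_one hv
  have h : v 0 ^ 2 + v 1 ^ 2 + v 2 ^ 2 - 1 ≠ 0 := by linarith
  simpa [numer] using h

lemma numer_succ (v : Space) (j : Fin 3) : numer v j.succ = 4 * v j ^ 2 := by
  fin_cases j <;> rfl

/-- The normalized cubic is smooth in the point even where its individual zeros are not. -/
lemma contDiff_prod_sub_coord (ha : StrictMono a) (σ : ℝ) :
    ContDiff ℝ 2 fun v => ∏ i, (σ - coord a v i) := by
  have e : (fun v => ∏ i, (σ - coord a v i)) = fun v => weighted a (numer v) σ / conf v ^ 2 := by
    funext v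
    rw [weighted_numer ha, mul_div_cancel_left₀ _ (pow_pos (conf_pos v) 2).ne']
  rw [e]
  have h1 : ContDiff ℝ 2 fun v : Space => weighted a (numer v) σ :=
    ContDiff.comp (g := fun q : Space × ℝ => weighted a (numer q.1) q.2)
      (f := fun v : Space => (v, σ)) (contDiff_weighted a) (by fun_prop)
  have h2 : ContDiff ℝ 2 fun v : Space => conf v ^ 2 := contDiff_conf.pow 2
  exact h1.div h2 fun v => (pow_pos (conf_pos v) 2).ne'

/-- The product of the radial functions, divided by the envelopes, is smooth near a point where
two coordinates coincide with `a_j`. -/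
lemma exists_smooth_of_double (ha : StrictMono a) (h : IsRadialTriple a p l₁ l₂ E V) {v₀ : Space}
    {j i k m : Fin 3} (hperm : ∀ f : Fin 3 → ℝ, ∏ x, f x = f i * f k * f m)
    (hij : j.succ = i.castSucc ∨ j.succ = i.succ) (hkj : j.succ = k.castSucc ∨ j.succ = k.succ)
    (hi : coord a v₀ i = a j.succ) (hk : coord a v₀ k = a j.succ)
    (hm : ∀ x ≠ m, coord a v₀ x ≠ coord a v₀ m) (hm0 : coord a v₀ m ≠ a 0) :
    ∃ H : Space → ℝ, ContDiffAt ℝ 2 H v₀ ∧ ∀ᶠ v in 𝓝 v₀,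
      ∏ x, E x (coord a v x) = (∏ x, envelope a p (coord a v x)) * H v := by
  have hc : ∀ x, Continuous fun v => coord a v x := fun x =>
    (continuous_apply x).comp (continuous_coord ha)
  obtain ⟨g, hg, hgi⟩ := exists_local_factor ha h j
  obtain ⟨ci, hci⟩ := hgi i hij
  obtain ⟨ck, hck⟩ := hgi k hkj
  obtain ⟨F, hF, hFe⟩ := exists_contDiffAt_symmetric hg
  obtain ⟨f, hf, hfe⟩ := exists_smooth_factor ha h m (coord_mem_Icc ha v₀ m) hm0
  have hsm := contDiffAt_coord ha hm
  have w : ∀ σ, ContDiffAt ℝ 2 (fun v => ∏ x, (σ - coord a v x)) v₀ := fun σ =>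
    (contDiff_prod_sub_coord ha σ).contDiffAt
  -- For the monic cubic M with zeros s_x, M(1) + M(-1) - 2M(0) = -2(s₁ + s₂ + s₃); the simple zero
  -- s_m is then subtracted.
  have hsum : ContDiffAt ℝ 2 (fun v => coord a v i + coord a v k) v₀ := by
    have e : (fun v => coord a v i + coord a v k) = fun v =>
        -((∏ x, (1 - coord a v x)) + (∏ x, (-1 - coord a v x)) - 2 * ∏ x, (0 - coord a v x)) / 2 -
          coord a v m := by
      funext v
      simp only [hperm]
      ring
    rw [e]
    have h1 := w 1
    have h2 := w (-1)
    have h3 := w 0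
    fun_prop
  -- Here (M(1) - M(-1) - 2)/2 is the second elementary symmetric function, from which s_i s_k and
  -- then the discriminant are recovered.
  have hdisc : ContDiffAt ℝ 2 (fun v => ((coord a v i - coord a v k) / 2) ^ 2) v₀ := by
    have e : (fun v => ((coord a v i - coord a v k) / 2) ^ 2) = fun v =>
        ((coord a v i + coord a v k) ^ 2 - 4 * (((∏ x, (1 - coord a v x)) -
          (∏ x, (-1 - coord a v x)) - 2) / 2 - coord a v m * (coord a v i + coord a v k))) / 4 := by
      funext v
      simp only [hperm]
      ring
    rw [e]
    have h1 := w 1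
    have h2 := w (-1)
    fun_prop
  refine ⟨fun v => ci * ck * F ((coord a v i + coord a v k) / 2,
    ((coord a v i - coord a v k) / 2) ^ 2) * f (coord a v m), ?_, ?_⟩
  · have h1 : ContDiffAt ℝ 2 (fun v => F ((coord a v i + coord a v k) / 2,
        ((coord a v i - coord a v k) / 2) ^ 2)) v₀ := by
      refine ContDiffAt.comp (g := F) v₀ ?_ ((hsum.div_const 2).prodMk hdisc)
      convert hF using 2
      · rw [hi, hk]; ring
      · rw [hi, hk]; ring
    have h2 : ContDiffAt ℝ 2 (fun v => f (coord a v m)) v₀ := ContDiffAt.comp (g := f) v₀ hf hsm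
    exact (contDiffAt_const.mul h1).mul h2
  · have ti := (hc i).tendsto v₀
    have tk := (hc k).tendsto v₀
    have tm := (hc m).tendsto v₀
    simp only [hi] at ti
    simp only [hk] at tk
    filter_upwards [ti.eventually hci, tk.eventually hck, tm.eventually hfe,
      (ti.prodMk_nhds tk).eventually hFe] with v h1 h2 h3 h4
    rw [hperm, hperm, h1 (coord_mem_Icc ha v i), h2 (coord_mem_Icc ha v k),
      h3 (coord_mem_Icc ha v m), ← h4]
    ring

lemma exists_smooth_of_distinct (ha : StrictMono a) (h : IsRadialTriple a p l₁ l₂ E V)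
    {v₀ : Space} (hd : ∀ x y, x ≠ y → coord a v₀ x ≠ coord a v₀ y)
    (h0 : ∀ x, coord a v₀ x ≠ a 0) :
    ∃ H : Space → ℝ, ContDiffAt ℝ 2 H v₀ ∧ ∀ᶠ v in 𝓝 v₀,
      ∏ x, E x (coord a v x) = (∏ x, envelope a p (coord a v x)) * H v := by
  have hc : ∀ x, Continuous fun v => coord a v x := fun x =>
    (continuous_apply x).comp (continuous_coord ha)
  choose f hf hfe using fun x => exists_smooth_factor ha h x (coord_mem_Icc ha v₀ x) (h0 x)
  refine ⟨fun v => ∏ x, f x (coord a v x), ?_, ?_⟩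
  · exact contDiffAt_prod fun x _ => ContDiffAt.comp (g := f x) v₀ (hf x)
      (contDiffAt_coord ha fun y hy => hd y x hy)
  · have : ∀ᶠ v in 𝓝 v₀, ∀ x, coord a v x ∈ Icc (a x.castSucc) (a x.succ) →
        E x (coord a v x) = envelope a p (coord a v x) * f x (coord a v x) :=
      eventually_all.2 fun x => ((hc x).tendsto v₀).eventually (hfe x)
    filter_upwards [this] with v hv
    rw [← Finset.prod_mul_distrib]
    exact Finset.prod_congr rfl fun x _ => hv x (coord_mem_Icc ha v x)

/-- Adjacent intervals share only an end point, so coordinates can merge only as s₁ = s₂ = a₁ or s₂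
= s₃ = a₂. The two cannot occur together since a₁ < a₂, so the third zero is always simple. -/
lemma exists_smooth_quotient (ha : StrictMono a) (h : IsRadialTriple a p l₁ l₂ E V) {v₀ : Space}
    (hv : v₀ ∈ Metric.ball (0 : Space) 1) :
    ∃ H : Space → ℝ, ContDiffAt ℝ 2 H v₀ ∧ ∀ᶠ v in 𝓝 v₀,
      ∏ x, E x (coord a v x) = (∏ x, envelope a p (coord a v x)) * H v := by
  have h0 : ∀ x, coord a v₀ x ≠ a 0 := coord_ne_of_numer_ne_zero ha (numer_zero_ne_zero hv)
  have m0 : coord a v₀ 0 ∈ Icc (a 0) (a 1) := coord_mem_Icc ha v₀ 0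
  have m1 : coord a v₀ 1 ∈ Icc (a 1) (a 2) := coord_mem_Icc ha v₀ 1
  have m2 : coord a v₀ 2 ∈ Icc (a 2) (a 3) := coord_mem_Icc ha v₀ 2
  have h12 : a 1 < a 2 := ha (by decide)
  by_cases e1 : coord a v₀ 0 = coord a v₀ 1
  · have e2 : coord a v₀ 0 = a 1 := le_antisymm m0.2 (e1 ▸ m1.1)
    have e3 : coord a v₀ 1 = a 1 := e1 ▸ e2
    refine exists_smooth_of_double ha h (j := 0) (i := 0) (k := 1) (m := 2)
      Fin.prod_univ_three (Or.inr rfl) (Or.inl rfl) e2 e3 ?_ (h0 2)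
    have hlt : a 1 < coord a v₀ 2 := h12.trans_le m2.1
    intro x hx
    fin_cases x
    · exact (e2.trans_lt hlt).ne
    · exact (e3.trans_lt hlt).ne
    · exact absurd rfl hx
  by_cases e2 : coord a v₀ 1 = coord a v₀ 2
  · have e3 : coord a v₀ 1 = a 2 := le_antisymm m1.2 (e2 ▸ m2.1)
    have e4 : coord a v₀ 2 = a 2 := e2 ▸ e3
    refine exists_smooth_of_double ha h (j := 1) (i := 1) (k := 2) (m := 0)
      (fun f => by rw [Fin.prod_univ_three]; ring) (Or.inr rfl) (Or.inl rfl) e3 e4 ?_ (h0 0)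
    have hlt : coord a v₀ 0 < a 2 := m0.2.trans_lt h12
    intro x hx
    fin_cases x
    · exact absurd rfl hx
    · exact (hlt.trans_eq e3.symm).ne'
    · exact (hlt.trans_eq e4.symm).ne'
  · have l1 : coord a v₀ 0 < coord a v₀ 1 := lt_of_le_of_ne (m0.2.trans m1.1) e1
    have l2 : coord a v₀ 1 < coord a v₀ 2 := lt_of_le_of_ne (m1.2.trans m2.1) e2
    refine exists_smooth_of_distinct ha h (fun x y hxy => ?_) h0
    fin_cases x <;> fin_cases y
    · exact absurd rfl hxy
    · exact l1.ne
    · exact (l1.trans l2).ne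
    · exact l1.ne'
    · exact absurd rfl hxy
    · exact l2.ne
    · exact (l1.trans l2).ne'
    · exact l2.ne'
    · exact absurd rfl hxy

/-- Square root of the identity `numer_mul_cofactor` at a_j, taken to the power p_j: the fractional
powers combine to |v_j|, up to a constant and the conformal factor. -/
lemma prod_envelope (ha : StrictMono a) (p : Fin 3 → Fin 2) (v : Space) :
    ∏ x, envelope a p (coord a v x) =
      ∏ j : Fin 3, (2 * √|cofactor a j.succ (a j.succ)| * |v j| / conf v) ^ (p j : ℕ) := by
  unfold envelope
  rw [Finset.prod_comm]
  refine Finset.prod_congr rfl fun j _ => ?_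
  rw [Finset.prod_pow]
  congr 1
  have h := numer_mul_cofactor ha v j.succ
  rw [numer_succ] at h
  have hK := conf_pos v
  have e1 : ∏ x, √|coord a v x - a j.succ| = √(∏ x, |coord a v x - a j.succ|) := by
    simp only [Fin.prod_univ_three]
    rw [Real.sqrt_mul (by positivity), Real.sqrt_mul (by positivity)]
  have e2 : ∏ x, |coord a v x - a j.succ| =
      (2 * |v j| / conf v) ^ 2 * |cofactor a j.succ (a j.succ)| := by
    have e3 : ∏ x, |coord a v x - a j.succ| = |∏ x, (a j.succ - coord a v x)| := by
      rw [Finset.abs_prod]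
      exact Finset.prod_congr rfl fun x _ => abs_sub_comm _ _
    have e4 : ∏ x, (a j.succ - coord a v x) =
        4 * v j ^ 2 / conf v ^ 2 * cofactor a j.succ (a j.succ) := by
      field_simp
      linear_combination -h
    rw [e3, e4, abs_mul, abs_of_nonneg (by positivity), div_pow, mul_pow, sq_abs]
    norm_num
  rw [e1, e2, Real.sqrt_mul (by positivity), Real.sqrt_sq (by positivity)]
  ring

lemma sign_mul_abs_pow (x c : ℝ) (e : Fin 2) :
    (if x < 0 then (-1 : ℝ) ^ (e : ℕ) else 1) * (c * |x|) ^ (e : ℕ) = (c * x) ^ (e : ℕ) := by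
  obtain rfl | rfl : e = 0 ∨ e = 1 := by omega
  · simp
  · split_ifs with h
    · simp [abs_of_neg h]
    · simp [abs_of_nonneg (not_lt.1 h)]

lemma numer_foldOctant (v : Space) : numer (foldOctant v) = numer v := by
  funext j
  fin_cases j <;> simp [numer, foldOctant]

lemma coord_foldOctant (a : Fin 4 → ℝ) (v : Space) : coord a (foldOctant v) = coord a v := by
  funext i
  simp only [coord, cubic, numer_foldOctant]

lemma conf_foldOctant (v : Space) : conf (foldOctant v) = conf v := by
  simp [conf, foldOctant]

/-- The three functions of one variable as a family. -/
def radialFamily (a : Fin 4 → ℝ) (u₁ u₂ u₃ : ℝ → ℝ) (i : Fin 3) (s : ℝ) : ℝ :=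
  ![u₁, u₂, u₃] i (bigOmega a s)

lemma harmonicG_eq (a : Fin 4 → ℝ) (p : Fin 3 → Fin 2) (u₁ u₂ u₃ : ℝ → ℝ) (v : Space) :
    harmonicG a p u₁ u₂ u₃ v = (∏ i : Fin 3, if v i < 0 then (-1 : ℝ) ^ (p i : ℕ) else 1) *
      (conf v ^ (-(1 / 2) : ℝ) * ∏ x, radialFamily a u₁ u₂ u₃ x (coord a v x)) := by
  have h : separated a u₁ u₂ u₃ (foldOctant v) = conf (foldOctant v) ^ (-(1 / 2) : ℝ) *
      ∏ x, radialFamily a u₁ u₂ u₃ x (coord a (foldOctant v) x) := by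
    rw [Fin.prod_univ_three]
    rfl
  rw [harmonicG, h, conf_foldOctant, coord_foldOctant]

/-- The reflection signs turn |v_j|^(p_j) into v_j^(p_j), so the only factors that were not smooth
across the planes become monomials. -/
lemma exists_eventually_harmonicG_eq (ha : StrictMono a) {u₁ u₂ u₃ : ℝ → ℝ}
    (h : IsRadialTriple a p l₁ l₂ (radialFamily a u₁ u₂ u₃) V) {v₀ : Space}
    (hv : v₀ ∈ Metric.ball (0 : Space) 1) :
    ∃ H : Space → ℝ, ContDiffAt ℝ 2 H v₀ ∧ ∀ᶠ v in 𝓝 v₀, harmonicG a p u₁ u₂ u₃ v =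
      (∏ j : Fin 3, (2 * √|cofactor a j.succ (a j.succ)| / conf v * v j) ^ (p j : ℕ)) * H v := by
  obtain ⟨H, hH, hHe⟩ := exists_smooth_quotient ha h hv
  refine ⟨fun v => conf v ^ (-(1 / 2) : ℝ) * H v, ?_, ?_⟩
  · exact (contDiff_conf.contDiffAt.rpow_const_of_ne (conf_pos v₀).ne').mul hH
  · filter_upwards [hHe] with v hv
    rw [harmonicG_eq, hv, prod_envelope ha]
    have e : ∏ j : Fin 3, (2 * √|cofactor a j.succ (a j.succ)| / conf v * v j) ^ (p j : ℕ) =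
        (∏ i : Fin 3, if v i < 0 then (-1 : ℝ) ^ (p i : ℕ) else 1) *
          ∏ j : Fin 3, (2 * √|cofactor a j.succ (a j.succ)| * |v j| / conf v) ^ (p j : ℕ) := by
      rw [← Finset.prod_mul_distrib]
      refine Finset.prod_congr rfl fun j _ => ?_
      rw [← sign_mul_abs_pow]
      congr 2
      ring
    rw [e]
    ring

theorem contDiffAt_harmonicG (ha : StrictMono a) {u₁ u₂ u₃ : ℝ → ℝ}
    (h : IsRadialTriple a p l₁ l₂ (radialFamily a u₁ u₂ u₃) V) {v₀ : Space}
    (hv : v₀ ∈ Metric.ball (0 : Space) 1) : ContDiffAt ℝ 2 (harmonicG a p u₁ u₂ u₃) v₀ := by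
  obtain ⟨H, hH, hHe⟩ := exists_eventually_harmonicG_eq ha h hv
  refine ContDiffAt.congr_of_eventuallyEq ?_ hHe
  refine ContDiffAt.mul (contDiffAt_prod fun j _ => ContDiffAt.pow ?_ _) hH
  have h1 : ContDiffAt ℝ 2 (fun v : Space => v j) v₀ := by fun_prop
  exact (contDiffAt_const.div contDiff_conf.contDiffAt (conf_pos v₀).ne').mul h1

lemma reflect_apply (i j : Fin 3) (v : Space) : reflect i v j = if j = i then -v j else v j := rfl

lemma numer_reflect (i : Fin 3) (v : Space) : numer (reflect i v) = numer v := by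
  have h : ∀ j, reflect i v j ^ 2 = v j ^ 2 := fun j => by
    rw [reflect_apply]; split_ifs <;> simp
  funext j
  fin_cases j <;> simp [numer, h]

lemma coord_reflect (a : Fin 4 → ℝ) (i : Fin 3) (v : Space) :
    coord a (reflect i v) = coord a v := by
  funext k
  simp only [coord, cubic, numer_reflect]

lemma conf_reflect (i : Fin 3) (v : Space) : conf (reflect i v) = conf v := by
  have h : ∀ j, reflect i v j ^ 2 = v j ^ 2 := fun j => by
    rw [reflect_apply]; split_ifs <;> simp
  simp [conf, h]

theorem hasParityOn_harmonicG (ha : StrictMono a) {u₁ u₂ u₃ : ℝ → ℝ}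
    (h : IsRadialTriple a p l₁ l₂ (radialFamily a u₁ u₂ u₃) V) :
    HasParityOn p (harmonicG a p u₁ u₂ u₃) (Metric.ball (0 : Space) 1) := by
  intro v hv i
  by_cases h0 : v i = 0
  · have e : reflect i v = v := by
      ext j
      rw [reflect_apply]
      split_ifs with hj
      · rw [hj, h0, neg_zero]
      · rfl
    rw [e]
    obtain h1 | h1 : p i = 0 ∨ p i = 1 := by omega
    · simp [h1]
    -- On the plane itself odd parity demands G = 0, which the sign factor cannot supply; it comes
    -- from the monomial v_i.
    · obtain ⟨H, -, hH⟩ := exists_eventually_harmonicG_eq ha h hv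
      rw [hH.self_of_nhds, Finset.prod_eq_zero (Finset.mem_univ i) (by simp [h0, h1])]
      simp
  · rw [harmonicG_eq, harmonicG_eq, coord_reflect, conf_reflect]
    have e : (∏ j : Fin 3, if reflect i v j < 0 then (-1 : ℝ) ^ (p j : ℕ) else 1) =
        (-1) ^ (p i : ℕ) * ∏ j : Fin 3, if v j < 0 then (-1 : ℝ) ^ (p j : ℕ) else 1 := by
      rw [← Finset.mul_prod_erase _ _ (Finset.mem_univ i),
        ← Finset.mul_prod_erase (a := i) _ (fun j => if v j < 0 then (-1 : ℝ) ^ (p j : ℕ) else 1)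
          (Finset.mem_univ i), ← mul_assoc]
      congr 1
      · have hs : (-1 : ℝ) ^ (p i : ℕ) * (-1) ^ (p i : ℕ) = 1 := by
          rw [← mul_pow]; norm_num
        rw [reflect_apply, if_pos rfl]
        rcases lt_or_gt_of_ne h0 with h1 | h1
        · rw [if_neg (by linarith), if_pos h1, hs]
        · rw [if_pos (by linarith), if_neg (by linarith), mul_one]
      · refine Finset.prod_congr rfl fun j hj => ?_
        rw [reflect_apply, if_neg (Finset.ne_of_mem_erase hj)]
    rw [e]
    ring

end Regularity

/-! ### The Laplacian of S³ in stereographic coordinates -/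

section ConformalCalculus

open Laplacian

/-- The partial derivative of `f` in the direction of the `k`-th coordinate. -/
def pd (k : Fin 3) (f : Space → ℝ) (v : Space) : ℝ :=
  fderiv ℝ f v (EuclideanSpace.basisFun (Fin 3) ℝ k)

lemma laplacian_eq_sum_pd {f : Space → ℝ} {v : Space} (hf : ContDiffAt ℝ 2 f v) :
    Δ f v = ∑ k, pd k (pd k f) v := by
  rw [InnerProductSpace.laplacian_eq_iteratedFDeriv_orthonormalBasis f
    (EuclideanSpace.basisFun (Fin 3) ℝ)]
  refine Finset.sum_congr rfl fun k _ => ?_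
  have hd : DifferentiableAt ℝ (fderiv ℝ f) v :=
    (hf.fderiv_right (m := 1) (by norm_num)).differentiableAt (by norm_num)
  rw [iteratedFDeriv_two_apply]
  have : fderiv ℝ (pd k f) v = (fderiv ℝ (fderiv ℝ f) v).flip
      (EuclideanSpace.basisFun (Fin 3) ℝ k) := by
    unfold pd
    rw [fderiv_clm_apply hd (differentiableAt_const _)]
    simp
  rw [pd, this]
  simp

lemma differentiableAt_pd {f : Space → ℝ} {v : Space} (hf : ContDiffAt ℝ 2 f v) (k : Fin 3) :
    DifferentiableAt ℝ (pd k f) v := by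
  have hd : DifferentiableAt ℝ (fderiv ℝ f) v :=
    (hf.fderiv_right (m := 1) (by norm_num)).differentiableAt (by norm_num)
  exact hd.clm_apply (differentiableAt_const _)

lemma ContDiffAt.diff_of_two {f : Space → ℝ} {v : Space} (hf : ContDiffAt ℝ 2 f v) :
    DifferentiableAt ℝ f v := hf.differentiableAt (by norm_num)

lemma pd_congr {f g : Space → ℝ} {v : Space} (h : f =ᶠ[𝓝 v] g) (k : Fin 3) :
    pd k f v = pd k g v := by
  rw [pd, pd, h.fderiv_eq]

lemma eventually_differentiableAt {f : Space → ℝ} {v : Space} (hf : ContDiffAt ℝ 2 f v) :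
    ∀ᶠ w in 𝓝 v, DifferentiableAt ℝ f w := by
  filter_upwards [hf.eventually (by simp)] with w hw using ContDiffAt.diff_of_two hw

lemma pd_add {f g : Space → ℝ} {v : Space} (hf : DifferentiableAt ℝ f v)
    (hg : DifferentiableAt ℝ g v) (k : Fin 3) :
    pd k (fun w => f w + g w) v = pd k f v + pd k g v := by
  rw [pd, fderiv_fun_add hf hg]; rfl

lemma pd_mul {f g : Space → ℝ} {v : Space} (hf : DifferentiableAt ℝ f v)
    (hg : DifferentiableAt ℝ g v) (k : Fin 3) :
    pd k (fun w => f w * g w) v = f v * pd k g v + g v * pd k f v := by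
  rw [pd, fderiv_fun_mul hf hg]; rfl

lemma pd_const (c : ℝ) (k : Fin 3) (v : Space) : pd k (fun _ => c) v = 0 := by
  simp [pd]

lemma pd_comp {φ : ℝ → ℝ} {φ' : ℝ} {f : Space → ℝ} {v : Space} (hφ : HasDerivAt φ φ' (f v))
    (hf : DifferentiableAt ℝ f v) (k : Fin 3) : pd k (fun w => φ (f w)) v = φ' * pd k f v := by
  have := hφ.comp_hasFDerivAt v hf.hasFDerivAt
  rw [pd, show (fun w => φ (f w)) = φ ∘ f from rfl, this.fderiv]
  rfl

lemma pd_pd_add {f g : Space → ℝ} {v : Space} (hf : ContDiffAt ℝ 2 f v)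
    (hg : ContDiffAt ℝ 2 g v) (k : Fin 3) :
    pd k (pd k fun w => f w + g w) v = pd k (pd k f) v + pd k (pd k g) v := by
  rw [← pd_add (differentiableAt_pd hf k) (differentiableAt_pd hg k)]
  refine pd_congr ?_ k
  filter_upwards [eventually_differentiableAt hf, eventually_differentiableAt hg] with w h1 h2
    using pd_add h1 h2 k

lemma pd_pd_mul {f g : Space → ℝ} {v : Space} (hf : ContDiffAt ℝ 2 f v)
    (hg : ContDiffAt ℝ 2 g v) (k : Fin 3) :
    pd k (pd k fun w => f w * g w) v =
      f v * pd k (pd k g) v + g v * pd k (pd k f) v + 2 * (pd k f v * pd k g v) := by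
  have e : (pd k fun w => f w * g w) =ᶠ[𝓝 v] fun w => f w * pd k g w + g w * pd k f w := by
    filter_upwards [eventually_differentiableAt hf, eventually_differentiableAt hg] with w h1 h2
      using pd_mul h1 h2 k
  have hf1 := ContDiffAt.diff_of_two hf
  have hg1 := ContDiffAt.diff_of_two hg
  have hf2 := differentiableAt_pd hf k
  have hg2 := differentiableAt_pd hg k
  rw [pd_congr e, pd_add (hf1.fun_mul hg2) (hg1.fun_mul hf2), pd_mul hf1 hg2, pd_mul hg1 hf2]
  ring

lemma pd_pd_comp {φ φ₁ : ℝ → ℝ} {φ₂ : ℝ} {f : Space → ℝ} {v : Space}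
    (h1 : ∀ᶠ t in 𝓝 (f v), HasDerivAt φ (φ₁ t) t) (h2 : HasDerivAt φ₁ φ₂ (f v))
    (hf : ContDiffAt ℝ 2 f v) (k : Fin 3) :
    pd k (pd k fun w => φ (f w)) v =
      φ₁ (f v) * pd k (pd k f) v + φ₂ * (pd k f v * pd k f v) := by
  have e : (pd k fun w => φ (f w)) =ᶠ[𝓝 v] fun w => φ₁ (f w) * pd k f w := by
    filter_upwards [eventually_differentiableAt hf, hf.continuousAt.eventually h1] with w h3 h4
      using pd_comp h4 h3 k
  have hf1 := ContDiffAt.diff_of_two hf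
  have hc : DifferentiableAt ℝ (fun w => φ₁ (f w)) v := h2.differentiableAt.comp v hf1
  rw [pd_congr e, pd_mul hc (differentiableAt_pd hf k),
    pd_comp h2 hf1]
  ring

/-- The radial derivative. -/
def euler (f : Space → ℝ) (v : Space) : ℝ := ∑ k, v k * pd k f v

/-- The Laplacian of the unit sphere in stereographic coordinates. -/
def sphLap (f : Space → ℝ) (v : Space) : ℝ :=
  (conf v ^ 2 * ∑ k, pd k (pd k f) v - 2 * conf v * euler f v) / 4

/-- The carré du champ of `sphLap`. -/
def carre (f g : Space → ℝ) (v : Space) : ℝ := conf v ^ 2 / 4 * ∑ k, pd k f v * pd k g v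

variable {f g h : Space → ℝ} {v : Space}

lemma carre_comm (f g : Space → ℝ) (v : Space) : carre f g v = carre g f v := by
  simp only [carre, mul_comm]

lemma carre_add (hf : DifferentiableAt ℝ f v) (hg : DifferentiableAt ℝ g v) :
    carre (fun w => f w + g w) h v = carre f h v + carre g h v := by
  simp only [carre, Fin.sum_univ_three, pd_add hf hg]
  ring

lemma carre_mul (hf : DifferentiableAt ℝ f v) (hg : DifferentiableAt ℝ g v) :
    carre (fun w => f w * g w) h v = f v * carre g h v + g v * carre f h v := by
  simp only [carre, Fin.sum_univ_three, pd_mul hf hg]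
  ring

lemma carre_const (c : ℝ) : carre (fun _ => c) h v = 0 := by
  simp [carre, pd_const]

lemma carre_comp {φ : ℝ → ℝ} {φ' : ℝ} (hφ : HasDerivAt φ φ' (f v)) (hf : DifferentiableAt ℝ f v) :
    carre (fun w => φ (f w)) h v = φ' * carre f h v := by
  simp only [carre, Fin.sum_univ_three, pd_comp hφ hf]
  ring

lemma carre_const_mul (c : ℝ) (hf : DifferentiableAt ℝ f v) :
    carre (fun w => c * f w) h v = c * carre f h v := by
  rw [carre_mul (differentiableAt_const c) hf, carre_const]
  ring

lemma carre_sum {ι : Type*} (s : Finset ι) {F : ι → Space → ℝ}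
    (hF : ∀ i ∈ s, DifferentiableAt ℝ (F i) v) :
    carre (fun w => ∑ i ∈ s, F i w) h v = ∑ i ∈ s, carre (F i) h v := by
  classical
  induction s using Finset.induction_on with
  | empty => simp [carre_const]
  | insert i s hi ih =>
    simp only [Finset.sum_insert hi]
    have hs : DifferentiableAt ℝ (fun w => ∑ i ∈ s, F i w) v :=
      DifferentiableAt.fun_sum fun j hj => hF j (Finset.mem_insert_of_mem hj)
    rw [carre_add (hF i (Finset.mem_insert_self i s)) hs,
      ih fun j hj => hF j (Finset.mem_insert_of_mem hj)]

lemma sphLap_add (hf : ContDiffAt ℝ 2 f v) (hg : ContDiffAt ℝ 2 g v) :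
    sphLap (fun w => f w + g w) v = sphLap f v + sphLap g v := by
  have hf1 := ContDiffAt.diff_of_two hf
  have hg1 := ContDiffAt.diff_of_two hg
  simp only [sphLap, euler, Fin.sum_univ_three, pd_pd_add hf hg, pd_add hf1 hg1]
  ring

lemma sphLap_mul (hf : ContDiffAt ℝ 2 f v) (hg : ContDiffAt ℝ 2 g v) :
    sphLap (fun w => f w * g w) v =
      f v * sphLap g v + g v * sphLap f v + 2 * carre f g v := by
  have hf1 := ContDiffAt.diff_of_two hf
  have hg1 := ContDiffAt.diff_of_two hg
  simp only [sphLap, carre, euler, Fin.sum_univ_three, pd_pd_mul hf hg, pd_mul hf1 hg1]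
  ring

lemma sphLap_comp {φ φ₁ : ℝ → ℝ} {φ₂ : ℝ} (h1 : ∀ᶠ t in 𝓝 (f v), HasDerivAt φ (φ₁ t) t)
    (h2 : HasDerivAt φ₁ φ₂ (f v)) (hf : ContDiffAt ℝ 2 f v) :
    sphLap (fun w => φ (f w)) v = φ₁ (f v) * sphLap f v + φ₂ * carre f f v := by
  have hf1 := ContDiffAt.diff_of_two hf
  simp only [sphLap, carre, euler, Fin.sum_univ_three, pd_pd_comp h1 h2 hf,
    pd_comp h1.self_of_nhds hf1]
  ring

lemma sphLap_const (c : ℝ) : sphLap (fun _ => c) v = 0 := by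
  have : ∀ k, pd k (fun _ : Space => c) = fun _ => 0 := fun k => funext fun w => pd_const c k w
  simp [sphLap, euler, this, pd_const]

lemma sphLap_const_mul (c : ℝ) (hf : ContDiffAt ℝ 2 f v) :
    sphLap (fun w => c * f w) v = c * sphLap f v := by
  rw [sphLap_mul contDiffAt_const hf, sphLap_const, carre_const]
  ring

lemma sphLap_sum {ι : Type*} (s : Finset ι) {F : ι → Space → ℝ}
    (hF : ∀ i ∈ s, ContDiffAt ℝ 2 (F i) v) :
    sphLap (fun w => ∑ i ∈ s, F i w) v = ∑ i ∈ s, sphLap (F i) v := by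
  classical
  induction s using Finset.induction_on with
  | empty => simp [sphLap_const]
  | insert i s hi ih =>
    simp only [Finset.sum_insert hi]
    have hs : ContDiffAt ℝ 2 (fun w => ∑ i ∈ s, F i w) v :=
      ContDiffAt.sum fun j hj => hF j (Finset.mem_insert_of_mem hj)
    rw [sphLap_add (hF i (Finset.mem_insert_self i s)) hs,
      ih fun j hj => hF j (Finset.mem_insert_of_mem hj)]

/-! ### The coordinates of the sphere -/

lemma contDiffAt_apply (k : Fin 3) : ContDiffAt ℝ 2 (fun w : Space => w k) v := by
  fun_prop

lemma pd_apply (k l : Fin 3) (v : Space) :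
    pd k (fun w : Space => w l) v = if l = k then 1 else 0 := by
  have : HasFDerivAt (fun w : Space => w l) (EuclideanSpace.proj l : Space →L[ℝ] ℝ) v :=
    (EuclideanSpace.proj l : Space →L[ℝ] ℝ).hasFDerivAt
  rw [pd, this.fderiv]
  simp

lemma carre_apply_apply (k l : Fin 3) (v : Space) :
    carre (fun w : Space => w k) (fun w : Space => w l) v =
      conf v ^ 2 / 4 * if k = l then 1 else 0 := by
  rw [carre]
  congr 1
  simp only [pd_apply]
  simp

lemma sphLap_apply (k : Fin 3) (v : Space) :
    sphLap (fun w : Space => w k) v = -(conf v * v k) / 2 := by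
  have : ∀ l, pd l (fun w : Space => w k) = fun _ => if k = l then 1 else 0 :=
    fun l => funext fun w => pd_apply l k w
  simp only [sphLap, euler, this, pd_const]
  simp
  ring

lemma conf_eq : conf = fun w : Space => (∑ k, w k * w k) + 1 := by
  funext w
  simp only [conf, Fin.sum_univ_three]
  ring

lemma contDiffAt_conf : ContDiffAt ℝ 2 conf v := contDiff_conf.contDiffAt

lemma pd_conf (k : Fin 3) (v : Space) : pd k conf v = 2 * v k := by
  have hd : ∀ l, DifferentiableAt ℝ (fun w : Space => w l) v := fun l =>
    ContDiffAt.diff_of_two (contDiffAt_apply l)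
  simp only [conf_eq, Fin.sum_univ_three]
  rw [pd_add (by fun_prop) (by fun_prop), pd_add (by fun_prop) (by fun_prop),
    pd_add (by fun_prop) (by fun_prop), pd_mul (hd 0) (hd 0), pd_mul (hd 1) (hd 1),
    pd_mul (hd 2) (hd 2), pd_const]
  simp only [pd_apply]
  fin_cases k <;> simp <;> ring

lemma carre_conf (g : Space → ℝ) (v : Space) : carre conf g v = conf v ^ 2 / 2 * euler g v := by
  simp only [carre, euler, pd_conf, Fin.sum_univ_three]
  ring

lemma carre_conf_apply (k : Fin 3) (v : Space) :
    carre conf (fun w : Space => w k) v = conf v ^ 2 / 2 * v k := by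
  rw [carre_conf, euler]
  simp [pd_apply]

lemma carre_conf_conf (v : Space) : carre conf conf v = conf v ^ 2 * (conf v - 1) := by
  rw [carre_conf, euler]
  simp only [pd_conf, Fin.sum_univ_three]
  rw [conf]
  ring

lemma sum_pd_pd_conf (v : Space) : ∑ k, pd k (pd k conf) v = 6 := by
  have : ∀ k, pd k conf = fun w => 2 * w k := fun k => funext fun w => pd_conf k w
  simp only [this]
  have h : ∀ k, pd k (fun w : Space => 2 * w k) v = 2 := fun k => by
    rw [pd_mul (by fun_prop) (by fun_prop), pd_const, pd_apply]
    simp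
  simp only [h]
  norm_num

lemma sphLap_conf (v : Space) : sphLap conf v = conf v ^ 2 / 2 + conf v := by
  rw [sphLap, sum_pd_pd_conf, euler]
  simp only [pd_conf, Fin.sum_univ_three]
  rw [conf]
  ring

/-- The function `2 / (ρ² + 1)`. -/
def invConf (v : Space) : ℝ := 2 * (conf v)⁻¹

lemma contDiffAt_invConf : ContDiffAt ℝ 2 invConf v :=
  contDiffAt_const.mul (contDiffAt_conf.inv (conf_pos v).ne')

lemma hasDerivAt_two_mul_inv {t : ℝ} (ht : t ≠ 0) :
    HasDerivAt (fun t : ℝ => 2 * t⁻¹) (-2 * (t ^ 2)⁻¹) t :=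
  ((hasDerivAt_inv ht).const_mul 2).congr_deriv (by ring)

lemma carre_invConf (g : Space → ℝ) (v : Space) :
    carre invConf g v = -2 * (conf v ^ 2)⁻¹ * carre conf g v :=
  carre_comp (hasDerivAt_two_mul_inv (conf_pos v).ne') (ContDiffAt.diff_of_two contDiffAt_conf)

lemma carre_invConf_apply (k : Fin 3) (v : Space) :
    carre invConf (fun w : Space => w k) v = -v k := by
  have := conf_pos v
  rw [carre_invConf, carre_conf_apply]
  field_simp

lemma carre_invConf_self (v : Space) :
    carre invConf invConf v = 2 * invConf v - invConf v ^ 2 := by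
  have := conf_pos v
  rw [carre_invConf, carre_comm, carre_invConf, carre_conf_conf, invConf]
  field_simp

lemma sphLap_invConf (v : Space) : sphLap invConf v = 3 - 3 * invConf v := by
  have hK := conf_pos v
  have h2 : HasDerivAt (fun t : ℝ => -2 * (t ^ 2)⁻¹) (4 * (conf v ^ 3)⁻¹) (conf v) := by
    refine ((((hasDerivAt_id (conf v)).pow 2).inv (by simpa using hK.ne')).const_mul
      (-2)).congr_deriv ?_
    simp
    field_simp
    ring
  have h := sphLap_comp (φ := fun t => 2 * t⁻¹) (f := conf) (v := v) (by
    filter_upwards [isOpen_ne.mem_nhds hK.ne'] with t ht using hasDerivAt_two_mul_inv ht) h2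
    contDiffAt_conf
  refine (show sphLap invConf v = _ from h).trans ?_
  rw [sphLap_conf, carre_conf_conf, invConf]
  field_simp
  ring

/-- The inverse stereographic projection to the unit sphere of `ℝ⁴`. -/
def theta (j : Fin 4) (v : Space) : ℝ :=
  Fin.cases (motive := fun _ => ℝ) (1 + -1 * invConf v) (fun k => invConf v * v k) j

lemma theta_zero : theta 0 = fun v => 1 + -1 * invConf v := rfl

lemma theta_succ (k : Fin 3) : theta k.succ = fun v => invConf v * v k := rfl

lemma contDiffAt_theta (j : Fin 4) : ContDiffAt ℝ 2 (theta j) v := by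
  have h := contDiffAt_invConf (v := v)
  induction j using Fin.cases with
  | zero => rw [theta_zero]; fun_prop
  | succ k => rw [theta_succ]; fun_prop

/-- This identifies the 5-cyclide coordinates with sphero-conal coordinates on S³. -/
lemma numer_eq_theta (j : Fin 4) (v : Space) : numer v j = conf v ^ 2 * theta j v ^ 2 := by
  have hK := conf_pos v
  induction j using Fin.cases with
  | zero =>
    simp only [theta_zero, invConf, numer, Matrix.cons_val_zero]
    field_simp
    rw [conf]
    ring
  | succ k =>
    rw [numer_succ]
    simp only [theta_succ, invConf]
    field_simp
    ring

lemma carre_theta_zero (h : Space → ℝ) (v : Space) :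
    carre (theta 0) h v = -carre invConf h v := by
  have hd : DifferentiableAt ℝ invConf v := ContDiffAt.diff_of_two contDiffAt_invConf
  rw [theta_zero, carre_add (by fun_prop) (by fun_prop), carre_const, carre_const_mul _ hd]
  ring

lemma carre_theta_succ (k : Fin 3) (h : Space → ℝ) (v : Space) :
    carre (theta k.succ) h v =
      invConf v * carre (fun w : Space => w k) h v + v k * carre invConf h v := by
  rw [theta_succ, carre_mul (ContDiffAt.diff_of_two contDiffAt_invConf) (by fun_prop)]

/-- The gradient on the sphere of a Cartesian coordinate is the tangential part of a basis vector,
hence these inner products. -/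
lemma carre_theta (i j : Fin 4) (v : Space) :
    carre (theta i) (theta j) v = (if i = j then 1 else 0) - theta i v * theta j v := by
  have hK := conf_pos v
  have hκ : invConf v * conf v = 2 := by rw [invConf]; field_simp
  have key0 : ∀ k : Fin 3, carre (theta 0) (theta k.succ) v = -(theta 0 v * theta k.succ v) := by
    intro k
    rw [carre_theta_zero, carre_comm, carre_theta_succ, carre_comm _ invConf, carre_invConf_apply,
      carre_invConf_self, theta_zero, theta_succ]
    ring
  induction i using Fin.cases with
  | zero =>
    induction j using Fin.cases with
    | zero =>
      rw [carre_theta_zero, carre_comm, carre_theta_zero, carre_invConf_self, theta_zero]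
      simp
      ring
    | succ k => rw [key0, if_neg (Fin.succ_ne_zero k).symm, zero_sub]
  | succ k =>
    induction j using Fin.cases with
    | zero => rw [carre_comm, key0, if_neg (Fin.succ_ne_zero k), zero_sub]; ring
    | succ l =>
      rw [carre_theta_succ, carre_comm _ (theta l.succ), carre_comm _ (theta l.succ),
        carre_theta_succ, carre_theta_succ, carre_invConf_self, carre_invConf_apply,
        carre_comm _ invConf, carre_invConf_apply, carre_apply_apply, theta_succ, theta_succ]
      simp only [Fin.succ_inj, eq_comm (a := l)]
      split_ifs
      · linear_combination (invConf v * conf v / 4 + 1 / 2) * hκ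
      · ring

/-- Linear functions are spherical harmonics of degree 1 on S³, with eigenvalue -1 · (1 + 2). -/
lemma sphLap_theta (j : Fin 4) (v : Space) : sphLap (theta j) v = -3 * theta j v := by
  have hκ : invConf v * conf v = 2 := by
    have hK := conf_pos v
    rw [invConf]; field_simp
  induction j using Fin.cases with
  | zero =>
    rw [theta_zero, sphLap_add contDiffAt_const (contDiffAt_const.mul contDiffAt_invConf),
      sphLap_const, sphLap_const_mul _ contDiffAt_invConf, sphLap_invConf]
    ring
  | succ k =>
    rw [theta_succ, sphLap_mul contDiffAt_invConf (contDiffAt_apply k), sphLap_apply,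
      sphLap_invConf, carre_invConf_apply]
    linear_combination (-v k / 2) * hκ

/-- Conformal covariance of the Laplacian. -/
lemma laplacian_conf_rpow_mul (hf : ContDiffAt ℝ 2 f v) :
    conf v ^ 2 / 4 * Δ (fun w => conf w ^ (-(1 / 2) : ℝ) * f w) v =
      conf v ^ (-(1 / 2) : ℝ) * (sphLap f v - 3 / 4 * f v) := by
  have hK := conf_pos v
  have hR : ContDiffAt ℝ 2 (fun w => conf w ^ (-(1 / 2) : ℝ)) v :=
    contDiffAt_conf.rpow_const_of_ne hK.ne'
  have h1 : ∀ t : ℝ, 0 < t → HasDerivAt (fun t : ℝ => t ^ (-(1 / 2) : ℝ))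
      (-(1 / 2) * (t ^ (-(1 / 2) : ℝ) * t⁻¹)) t := fun t ht => by
    refine (Real.hasDerivAt_rpow_const (Or.inl ht.ne')).congr_deriv ?_
    rw [Real.rpow_sub_one ht.ne']
    ring
  have h2 : HasDerivAt (fun t : ℝ => -(1 / 2) * (t ^ (-(1 / 2) : ℝ) * t⁻¹))
      (3 / 4 * conf v ^ (-(1 / 2) : ℝ) * (conf v ^ 2)⁻¹) (conf v) := by
    refine (((h1 _ hK).mul (hasDerivAt_inv hK.ne')).const_mul (-(1 / 2))).congr_deriv ?_
    field_simp
    ring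
  have h1e : ∀ᶠ t in 𝓝 (conf v), HasDerivAt (fun t : ℝ => t ^ (-(1 / 2) : ℝ))
      (-(1 / 2) * (t ^ (-(1 / 2) : ℝ) * t⁻¹)) t := by
    filter_upwards [Ioi_mem_nhds hK] with t ht using h1 t ht
  have hdc : DifferentiableAt ℝ conf v := ContDiffAt.diff_of_two contDiffAt_conf
  have hsum := sum_pd_pd_conf v
  rw [laplacian_eq_sum_pd (hR.mul hf)]
  simp only [pd_pd_mul hR hf, pd_pd_comp h1e h2 contDiffAt_conf, pd_comp (h1 _ hK) hdc,
    Fin.sum_univ_three, pd_conf, sphLap, euler] at hsum ⊢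
  set R := conf v ^ (-(1 / 2) : ℝ)
  have hcv : conf v = v 0 ^ 2 + v 1 ^ 2 + v 2 ^ 2 + 1 := rfl
  have e0 : pd 0 (pd 0 conf) v = 6 - pd 1 (pd 1 conf) v - pd 2 (pd 2 conf) v := by
    linear_combination hsum
  rw [e0]
  field_simp
  linear_combination (-24 * R * f v) * hcv

end ConformalCalculus

/-! ### Orthogonality and Laplacians of the coordinates -/

section CyclidicCalculus

variable {a : Fin 4 → ℝ}

/-- A generating function for the coordinates that is quadratic in θ, so its gradients and Laplacian
are explicit. Specializing σ to the value of a coordinate at the base point then isolates the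
derivatives of that coordinate. -/
lemma prod_sub_coord_eq (ha : StrictMono a) (σ : ℝ) (v : Space) :
    ∏ x, (σ - coord a v x) = ∑ j, cofactor a j σ * (theta j v * theta j v) := by
  have h := weighted_numer ha v σ
  simp only [weighted, numer_eq_theta] at h
  refine mul_left_cancel₀ (pow_pos (conf_pos v) 2).ne' (h.symm.trans ?_)
  rw [Finset.mul_sum]
  exact Finset.sum_congr rfl fun j _ => by ring

lemma differentiableAt_theta (j : Fin 4) (v : Space) : DifferentiableAt ℝ (theta j) v :=
  ContDiffAt.diff_of_two (contDiffAt_theta j)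

lemma sphLap_theta_sq (j : Fin 4) (v : Space) :
    sphLap (fun w => theta j w * theta j w) v = 2 - 8 * theta j v ^ 2 := by
  rw [sphLap_mul (contDiffAt_theta j) (contDiffAt_theta j), sphLap_theta, carre_theta, if_pos rfl]
  ring

lemma carre_theta_sq (i j : Fin 4) (v : Space) :
    carre (fun w => theta i w * theta i w) (fun w => theta j w * theta j w) v =
      4 * (theta i v * theta j v * ((if i = j then 1 else 0) - theta i v * theta j v)) := by
  rw [carre_mul (differentiableAt_theta i v) (differentiableAt_theta i v), carre_comm (theta i),
    carre_mul (differentiableAt_theta j v) (differentiableAt_theta j v), carre_comm (theta j),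
    carre_theta]
  ring

lemma sphLap_prod_sub_coord (ha : StrictMono a) (σ : ℝ) (v : Space) :
    sphLap (fun w => ∏ x, (σ - coord a w x)) v =
      2 * (∑ j, cofactor a j σ) - 8 * ∏ x, (σ - coord a v x) := by
  have hc : ∀ j, ContDiffAt ℝ 2 (fun w => theta j w * theta j w) v := fun j =>
    (contDiffAt_theta j).mul (contDiffAt_theta j)
  simp only [prod_sub_coord_eq ha]
  rw [sphLap_sum _ fun j _ => contDiffAt_const.mul (hc j), Finset.mul_sum, Finset.mul_sum,
    ← Finset.sum_sub_distrib]
  refine Finset.sum_congr rfl fun j _ => ?_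
  rw [sphLap_const_mul _ (hc j), sphLap_theta_sq]
  ring

lemma carre_prod_sub_coord (ha : StrictMono a) (σ τ : ℝ) (v : Space) :
    carre (fun w => ∏ x, (σ - coord a w x)) (fun w => ∏ x, (τ - coord a w x)) v =
      4 * ((∑ j, theta j v ^ 2 * (cofactor a j σ * cofactor a j τ)) -
        (∏ x, (σ - coord a v x)) * ∏ x, (τ - coord a v x)) := by
  have hd : ∀ j, DifferentiableAt ℝ (fun w => theta j w * theta j w) v := fun j =>
    (differentiableAt_theta j v).mul (differentiableAt_theta j v)
  have h1 : ∀ (σ : ℝ) (h : Space → ℝ),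
      carre (fun w => ∑ j, cofactor a j σ * (theta j w * theta j w)) h v =
        ∑ j, cofactor a j σ * carre (fun w => theta j w * theta j w) h v := fun σ h => by
    rw [carre_sum _ fun j _ => (differentiableAt_const _).fun_mul (hd j)]
    exact Finset.sum_congr rfl fun j _ => carre_const_mul _ (hd j)
  simp only [prod_sub_coord_eq ha]
  rw [h1, Finset.sum_mul, ← Finset.sum_sub_distrib, Finset.mul_sum]
  refine Finset.sum_congr rfl fun i _ => ?_
  rw [carre_comm, h1]
  simp only [carre_theta_sq, mul_sub, Finset.sum_sub_distrib, mul_ite, mul_one, mul_zero]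
  rw [Finset.sum_ite_eq' Finset.univ i, if_pos (Finset.mem_univ i), Finset.mul_sum,
    Finset.mul_sum, Finset.mul_sum]
  congr 1
  · ring
  · exact Finset.sum_congr rfl fun j _ => by ring

lemma hasDerivAt_nodal_sum (a : Fin 4 → ℝ) (s : ℝ) :
    HasDerivAt (nodal a) (∑ j, cofactor a j s) s := by
  have h := HasDerivAt.fun_finsetProd (u := Finset.univ) (f := fun (j : Fin 4) (s : ℝ) => s - a j)
    (f' := fun _ => 1) (x := s) fun j _ => (hasDerivAt_id s).sub_const (a j)
  exact h.congr_deriv (by simp [cofactor])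

variable {f g k : Space → ℝ} {v : Space}

lemma const_sub_eq (σ : ℝ) (f : Space → ℝ) : (fun w => σ - f w) = fun w => σ + -1 * f w := by
  funext w; ring

lemma carre_const_sub (σ : ℝ) (hf : DifferentiableAt ℝ f v) (h : Space → ℝ) :
    carre (fun w => σ - f w) h v = -carre f h v := by
  rw [const_sub_eq, carre_add (differentiableAt_const _) ((differentiableAt_const _).fun_mul hf),
    carre_const, carre_const_mul _ hf]
  ring

lemma sphLap_const_sub (σ : ℝ) (hf : ContDiffAt ℝ 2 f v) :
    sphLap (fun w => σ - f w) v = -sphLap f v := by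
  rw [const_sub_eq, sphLap_add contDiffAt_const (contDiffAt_const.mul hf), sphLap_const,
    sphLap_const_mul _ hf]
  ring

lemma carre_mul_mul (hf : DifferentiableAt ℝ f v) (hg : DifferentiableAt ℝ g v)
    (hk : DifferentiableAt ℝ k v) (h : Space → ℝ) :
    carre (fun w => f w * g w * k w) h v =
      g v * k v * carre f h v + f v * k v * carre g h v + f v * g v * carre k h v := by
  rw [carre_mul (hf.fun_mul hg) hk, carre_mul hf hg]
  ring

lemma sphLap_mul_mul (hf : ContDiffAt ℝ 2 f v) (hg : ContDiffAt ℝ 2 g v)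
    (hk : ContDiffAt ℝ 2 k v) :
    sphLap (fun w => f w * g w * k w) v =
      g v * k v * sphLap f v + f v * k v * sphLap g v + f v * g v * sphLap k v +
        2 * (k v * carre f g v + f v * carre g k v + g v * carre f k v) := by
  rw [sphLap_mul (hf.mul hg) hk, sphLap_mul hf hg,
    carre_mul (ContDiffAt.diff_of_two hf) (ContDiffAt.diff_of_two hg)]
  ring

lemma carre_prod_sub (σ : ℝ) (hf : DifferentiableAt ℝ f v) (hg : DifferentiableAt ℝ g v)
    (hk : DifferentiableAt ℝ k v) (h : Space → ℝ) :
    carre (fun w => (σ - f w) * (σ - g w) * (σ - k w)) h v =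
      -((σ - g v) * (σ - k v) * carre f h v + (σ - f v) * (σ - k v) * carre g h v +
        (σ - f v) * (σ - g v) * carre k h v) := by
  rw [carre_mul_mul (hf.const_sub σ) (hg.const_sub σ) (hk.const_sub σ), carre_const_sub σ hf,
    carre_const_sub σ hg, carre_const_sub σ hk]
  ring

lemma sphLap_prod_sub (σ : ℝ) (hf : ContDiffAt ℝ 2 f v) (hg : ContDiffAt ℝ 2 g v)
    (hk : ContDiffAt ℝ 2 k v) :
    sphLap (fun w => (σ - f w) * (σ - g w) * (σ - k w)) v =
      -((σ - g v) * (σ - k v) * sphLap f v + (σ - f v) * (σ - k v) * sphLap g v +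
        (σ - f v) * (σ - g v) * sphLap k v) +
        2 * ((σ - k v) * carre f g v + (σ - f v) * carre g k v + (σ - g v) * carre f k v) := by
  have hc : ∀ {f g : Space → ℝ}, ContDiffAt ℝ 2 f v → ContDiffAt ℝ 2 g v →
      carre (fun w => σ - f w) (fun w => σ - g w) v = carre f g v := fun {f g} hf hg => by
    rw [carre_const_sub σ (ContDiffAt.diff_of_two hf), carre_comm,
      carre_const_sub σ (ContDiffAt.diff_of_two hg), carre_comm, neg_neg]
  rw [sphLap_mul_mul (contDiffAt_const.sub hf) (contDiffAt_const.sub hg) (contDiffAt_const.sub hk),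
    sphLap_const_sub σ hf, sphLap_const_sub σ hg, sphLap_const_sub σ hk, hc hf hg, hc hg hk,
    hc hf hk]
  ring

variable {i j m : Fin 3}

/-- The generating function at σ = s_i, τ = s_j. Since P(s) = (s - a_l) C_l(s), multiplying Σ θ_l²
C_l(s_i) C_l(s_j) by s_i - s_j gives a combination of the values of the generating function at s_i
and s_j, which vanish. `hperm` makes i, j, m an enumeration of the three indices. -/
lemma carre_coord_of_ne (ha : StrictMono a) (hs : ∀ x, ContDiffAt ℝ 2 (fun w => coord a w x) v)
    (hperm : ∀ f : Fin 3 → ℝ, ∏ x, f x = f i * f j * f m)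
    (hij : coord a v i ≠ coord a v j) (him : coord a v i ≠ coord a v m)
    (hjm : coord a v j ≠ coord a v m) :
    carre (fun w => coord a w i) (fun w => coord a w j) v = 0 := by
  have hd := fun x => ContDiffAt.diff_of_two (hs x)
  have h0 : ∑ l, theta l v ^ 2 * (cofactor a l (coord a v i) * cofactor a l (coord a v j)) = 0 := by
    have e1 := prod_sub_coord_eq ha (coord a v i) v
    have e2 := prod_sub_coord_eq ha (coord a v j) v
    rw [Finset.prod_eq_zero (Finset.mem_univ i) (sub_self _)] at e1
    rw [Finset.prod_eq_zero (Finset.mem_univ j) (sub_self _)] at e2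
    refine mul_left_cancel₀ (sub_ne_zero.2 hij) ?_
    have e3 : (coord a v i - coord a v j) * ∑ l, theta l v ^ 2 *
        (cofactor a l (coord a v i) * cofactor a l (coord a v j)) =
        nodal a (coord a v i) * (∑ l, cofactor a l (coord a v j) * (theta l v * theta l v)) -
        nodal a (coord a v j) * ∑ l, cofactor a l (coord a v i) * (theta l v * theta l v) := by
      rw [Finset.mul_sum, Finset.mul_sum, Finset.mul_sum, ← Finset.sum_sub_distrib]
      refine Finset.sum_congr rfl fun l _ => ?_
      rw [nodal_eq a l, nodal_eq a l]
      ring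
    rw [e3, ← e1, ← e2]
    ring
  have h := carre_prod_sub_coord ha (coord a v i) (coord a v j) v
  rw [h0, Finset.prod_eq_zero (Finset.mem_univ i) (sub_self _)] at h
  simp only [hperm] at h
  rw [carre_prod_sub _ (hd i) (hd j) (hd m)] at h
  simp only [carre_comm _ (fun w => (coord a v j - coord a w i) * (coord a v j - coord a w j) *
    (coord a v j - coord a w m)), carre_prod_sub _ (hd i) (hd j) (hd m), sub_self] at h
  have h1 : (coord a v i - coord a v j) ^ 2 * ((coord a v i - coord a v m) *
      (coord a v j - coord a v m)) * carre (fun w => coord a w i) (fun w => coord a w j) v = 0 := by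
    rw [carre_comm]
    linear_combination -h
  exact (mul_eq_zero.1 h1).resolve_left (mul_ne_zero (pow_ne_zero _ (sub_ne_zero.2 hij))
    (mul_ne_zero (sub_ne_zero.2 him) (sub_ne_zero.2 hjm)))

/-- The diagonal case σ = τ = s_i, through C_l² = P' C_l - P C_l': the first term sums to zero, the
second to -P times the derivative of the generating function at its zero. -/
lemma carre_coord_self (ha : StrictMono a) (hs : ∀ x, ContDiffAt ℝ 2 (fun w => coord a w x) v)
    (hperm : ∀ f : Fin 3 → ℝ, ∏ x, f x = f i * f j * f m)
    (hij : coord a v i ≠ coord a v j) (him : coord a v i ≠ coord a v m) :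
    (coord a v i - coord a v j) * (coord a v i - coord a v m) *
      carre (fun w => coord a w i) (fun w => coord a w i) v = -4 * nodal a (coord a v i) := by
  have hd := fun x => ContDiffAt.diff_of_two (hs x)
  set s := coord a v i with hsi
  set c := (s - coord a v j) * (s - coord a v m) with hc
  have hc0 : c ≠ 0 := mul_ne_zero (sub_ne_zero.2 hij) (sub_ne_zero.2 him)
  have hder : ∑ l, deriv (cofactor a l) s * (theta l v * theta l v) = c := by
    have h1 : HasDerivAt (fun σ => ∑ l, cofactor a l σ * (theta l v * theta l v))
        (∑ l, deriv (cofactor a l) s * (theta l v * theta l v)) s :=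
      HasDerivAt.fun_sum fun l _ => (differentiable_cofactor a l s).hasDerivAt.mul_const _
    have h2 : HasDerivAt (fun σ => ∏ x, (σ - coord a v x)) c s := by
      simp only [hperm]
      have hx : ∀ x, HasDerivAt (fun σ => σ - coord a v x) 1 s := fun x =>
        (hasDerivAt_id s).sub_const _
      refine (((hx i).fun_mul (hx j)).fun_mul (hx m)).congr_deriv ?_
      rw [hc, hsi]
      ring
    simp only [prod_sub_coord_eq ha] at h2
    exact h1.unique h2
  have e1 := prod_sub_coord_eq ha s v
  rw [Finset.prod_eq_zero (Finset.mem_univ i) (sub_self _)] at e1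
  have h0 : ∑ l, theta l v ^ 2 * (cofactor a l s * cofactor a l s) = -nodal a s * c := by
    have e3 : ∑ l, theta l v ^ 2 * (cofactor a l s * cofactor a l s) =
        (∑ l, cofactor a l s) * (∑ l, cofactor a l s * (theta l v * theta l v)) -
          nodal a s * ∑ l, deriv (cofactor a l) s * (theta l v * theta l v) := by
      rw [Finset.mul_sum, Finset.mul_sum, ← Finset.sum_sub_distrib]
      refine Finset.sum_congr rfl fun l _ => ?_
      rw [(hasDerivAt_nodal_sum a s).unique (hasDerivAt_nodal a l s), nodal_eq a l]
      ring
    rw [e3, ← e1, hder]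
    ring
  have h := carre_prod_sub_coord ha s s v
  rw [h0, Finset.prod_eq_zero (Finset.mem_univ i) (sub_self _)] at h
  simp only [hperm] at h
  rw [carre_prod_sub _ (hd i) (hd j) (hd m)] at h
  simp only [carre_comm _ (fun w => (s - coord a w i) * (s - coord a w j) *
    (s - coord a w m)), carre_prod_sub _ (hd i) (hd j) (hd m), ← hsi, sub_self] at h
  refine mul_left_cancel₀ hc0 ?_
  linear_combination h

/-- At σ = s_i every term of the product rule has a factor σ - s_i or a mixed gradient product that
is zero by orthogonality, except the one with the Laplacian of s_i. The right side contains P'(s_i),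
matching the first order term of the radial equation. -/
lemma sphLap_coord (ha : StrictMono a) (hs : ∀ x, ContDiffAt ℝ 2 (fun w => coord a w x) v)
    (hperm : ∀ f : Fin 3 → ℝ, ∏ x, f x = f i * f j * f m)
    (hij : coord a v i ≠ coord a v j) (him : coord a v i ≠ coord a v m)
    (hjm : coord a v j ≠ coord a v m) :
    (coord a v i - coord a v j) * (coord a v i - coord a v m) * sphLap (fun w => coord a w i) v =
      -2 * ∑ l, cofactor a l (coord a v i) := by
  have h := sphLap_prod_sub_coord ha (coord a v i) v
  rw [Finset.prod_eq_zero (Finset.mem_univ i) (sub_self _)] at h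
  simp only [hperm] at h
  rw [sphLap_prod_sub _ (hs i) (hs j) (hs m), carre_coord_of_ne ha hs hperm hij him hjm,
    carre_coord_of_ne (m := j) ha hs (fun f => by rw [hperm]; ring) him hij hjm.symm] at h
  linear_combination -h

/-- `sphLap` of a radial function composed with its coordinate. -/
lemma sphLap_comp_coord {p : Fin 3 → Fin 2} {l₁ l₂ : ℝ} {E V : Fin 3 → ℝ → ℝ} (ha : StrictMono a)
    (h : IsRadialTriple a p l₁ l₂ E V) (hs : ∀ x, ContDiffAt ℝ 2 (fun w => coord a w x) v)
    (hmem : coord a v i ∈ Ioo (a i.castSucc) (a i.succ))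
    (hperm : ∀ f : Fin 3 → ℝ, ∏ x, f x = f i * f j * f m)
    (hij : coord a v i ≠ coord a v j) (him : coord a v i ≠ coord a v m)
    (hjm : coord a v j ≠ coord a v m) :
    (coord a v i - coord a v j) * (coord a v i - coord a v m) *
        sphLap (fun w => E i (coord a w i)) v =
      4 * vanVleck l₁ l₂ (coord a v i) * E i (coord a v i) := by
  obtain ⟨E₁, E₂, h1, h2, h3⟩ := exists_deriv_radial ha h i hmem (hasDerivAt_nodal_sum a _)
  rw [sphLap_comp (f := fun w => coord a w i) h1 h2 (hs i)]
  linear_combination E₂ * carre_coord_self ha hs hperm hij him +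
    E₁ (coord a v i) * sphLap_coord ha hs hperm hij him hjm - 4 * h3

lemma carre_comp_coord {φ ψ : ℝ → ℝ} (hs : ∀ x, ContDiffAt ℝ 2 (fun w => coord a w x) v)
    (hφ : DifferentiableAt ℝ φ (coord a v i)) (hψ : DifferentiableAt ℝ ψ (coord a v j))
    (h : carre (fun w => coord a w i) (fun w => coord a w j) v = 0) :
    carre (fun w => φ (coord a w i)) (fun w => ψ (coord a w j)) v = 0 := by
  rw [carre_comp (f := fun w => coord a w i) hφ.hasDerivAt (ContDiffAt.diff_of_two (hs i)),
    carre_comm, carre_comp (f := fun w => coord a w j) hψ.hasDerivAt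
      (ContDiffAt.diff_of_two (hs j)), carre_comm, h]
  ring

end CyclidicCalculus

/-! ### Separation of variables and extension by density -/

section Harmonic

open Laplacian

variable {a : Fin 4 → ℝ} {p : Fin 3 → Fin 2} {l₁ l₂ : ℝ} {E V : Fin 3 → ℝ → ℝ} {v : Space}

/-- Separation of variables. -/
theorem sphLap_prod_radial (ha : StrictMono a) (h : IsRadialTriple a p l₁ l₂ E V)
    (hmem : ∀ i : Fin 3, coord a v i ∈ Ioo (a i.castSucc) (a i.succ)) :
    ContDiffAt ℝ 2 (fun w => ∏ x, E x (coord a w x)) v ∧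
      sphLap (fun w => ∏ x, E x (coord a w x)) v = 3 / 4 * ∏ x, E x (coord a v x) := by
  have l01 : coord a v 0 < coord a v 1 := (hmem 0).2.trans (hmem 1).1
  have l12 : coord a v 1 < coord a v 2 := (hmem 1).2.trans (hmem 2).1
  have l02 := l01.trans l12
  have hne : ∀ i k : Fin 3, k ≠ i → coord a v k ≠ coord a v i := by
    intro i k hk
    fin_cases i <;> fin_cases k
    · exact absurd rfl hk
    · exact l01.ne'
    · exact l02.ne'
    · exact l01.ne
    · exact absurd rfl hk
    · exact l12.ne'
    · exact l02.ne
    · exact l12.ne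
    · exact absurd rfl hk
  have hs : ∀ x, ContDiffAt ℝ 2 (fun w => coord a w x) v := fun x =>
    contDiffAt_coord ha (hne x)
  have hE : ∀ x, ContDiffAt ℝ 2 (E x) (coord a v x) := fun x =>
    (contDiffOn_radial ha h x).contDiffAt (Ioo_mem_nhds (hmem x).1 (hmem x).2)
  have hEs : ∀ x, ContDiffAt ℝ 2 (fun w => E x (coord a w x)) v := fun x =>
    ContDiffAt.comp (g := E x) v (hE x) (hs x)
  have hEd : ∀ x, DifferentiableAt ℝ (E x) (coord a v x) := fun x =>
    (hE x).differentiableAt (by norm_num)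
  refine ⟨contDiffAt_prod fun x _ => hEs x, ?_⟩
  have p0 : ∀ f : Fin 3 → ℝ, ∏ x, f x = f 0 * f 1 * f 2 := Fin.prod_univ_three
  have p1 : ∀ f : Fin 3 → ℝ, ∏ x, f x = f 1 * f 2 * f 0 := fun f => by rw [p0]; ring
  have p2 : ∀ f : Fin 3 → ℝ, ∏ x, f x = f 2 * f 0 * f 1 := fun f => by rw [p0]; ring
  have q0 := sphLap_comp_coord ha h hs (hmem 0) p0 l01.ne l02.ne l12.ne
  have q1 := sphLap_comp_coord ha h hs (hmem 1) p1 l12.ne l01.ne' l02.ne'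
  have q2 := sphLap_comp_coord ha h hs (hmem 2) p2 l02.ne' l12.ne' l01.ne
  have c01 := carre_comp_coord hs (hEd 0) (hEd 1)
    (carre_coord_of_ne ha hs p0 l01.ne l02.ne l12.ne)
  have c12 := carre_comp_coord hs (hEd 1) (hEd 2)
    (carre_coord_of_ne ha hs p1 l12.ne l01.ne' l02.ne')
  have c02 := carre_comp_coord hs (hEd 0) (hEd 2) (carre_comm _ _ _ |>.trans
    (carre_coord_of_ne ha hs p2 l02.ne' l12.ne' l01.ne))
  simp only [Fin.prod_univ_three]
  rw [sphLap_mul_mul (hEs 0) (hEs 1) (hEs 2), c01, c12, c02]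
  simp only [vanVleck] at q0 q1 q2
  set x := coord a v 0
  set y := coord a v 1
  set z := coord a v 2
  have hxy : x - y ≠ 0 := sub_ne_zero.2 l01.ne
  have hxz : x - z ≠ 0 := sub_ne_zero.2 l02.ne
  have hyz : y - z ≠ 0 := sub_ne_zero.2 l12.ne
  -- After clearing the Vandermonde determinant, Σ Q(s_i)/∏_{k≠i}(s_i - s_k) becomes the leading
  -- coefficient of Q, so l₁ and l₂ cancel and 4 · 3/16 = 3/4 remains.
  refine mul_left_cancel₀ (mul_ne_zero (mul_ne_zero hxy hxz) hyz) ?_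
  linear_combination (y - z) * E 1 y * E 2 z * q0 - (x - z) * E 0 x * E 2 z * q1 +
    (x - y) * E 0 x * E 1 y * q2

lemma coord_mem_Ioo (ha : StrictMono a) (hv : v ∈ Metric.ball (0 : Space) 1)
    (h0 : ∀ i, v i ≠ 0) (i : Fin 3) : coord a v i ∈ Ioo (a i.castSucc) (a i.succ) := by
  have hn : ∀ j, numer v j ≠ 0 := fun j => by
    induction j using Fin.cases with
    | zero => exact numer_zero_ne_zero hv
    | succ k => rw [numer_succ]; exact mul_ne_zero (by norm_num) (pow_ne_zero _ (h0 k))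
  have hm := coord_mem_Icc ha v i
  exact ⟨lt_of_le_of_ne hm.1 (coord_ne_of_numer_ne_zero ha (hn _) i).symm,
    lt_of_le_of_ne hm.2 (coord_ne_of_numer_ne_zero ha (hn _) i)⟩

/-- Off the coordinate planes the sign factor is locally constant, and the eigenvalue 3/4 cancels
the zero order term of the conformal Laplacian. -/
lemma laplacian_harmonicG_of_ne_zero (ha : StrictMono a) {u₁ u₂ u₃ : ℝ → ℝ}
    (h : IsRadialTriple a p l₁ l₂ (radialFamily a u₁ u₂ u₃) V)
    (hv : v ∈ Metric.ball (0 : Space) 1) (h0 : ∀ i, v i ≠ 0) :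
    Δ (harmonicG a p u₁ u₂ u₃) v = 0 := by
  obtain ⟨hF, hL⟩ := sphLap_prod_radial ha h (coord_mem_Ioo ha hv h0)
  set F : Space → ℝ := fun w => ∏ x, radialFamily a u₁ u₂ u₃ x (coord a w x)
  set c : ℝ := ∏ i : Fin 3, if v i < 0 then (-1 : ℝ) ^ (p i : ℕ) else 1
  have hsign : ∀ᶠ w in 𝓝 v, ∀ i, (w i < 0 ↔ v i < 0) := by
    refine eventually_all.2 fun i => ?_
    have hc : ContinuousAt (fun w : Space => w i) v := by fun_prop
    rcases lt_or_gt_of_ne (h0 i) with h1 | h1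
    · filter_upwards [hc.eventually (Iio_mem_nhds h1)] with w hw
      exact iff_of_true hw h1
    · filter_upwards [hc.eventually (Ioi_mem_nhds h1)] with w hw
      exact iff_of_false (not_lt.2 (le_of_lt hw)) (not_lt.2 h1.le)
  have e : harmonicG a p u₁ u₂ u₃ =ᶠ[𝓝 v] fun w => conf w ^ (-(1 / 2) : ℝ) * (c * F w) := by
    filter_upwards [hsign] with w hw
    rw [harmonicG_eq]
    simp only [hw]
    ring
  rw [(InnerProductSpace.laplacian_congr_nhds e).self_of_nhds]
  have h1 := laplacian_conf_rpow_mul (contDiffAt_const.mul hF : ContDiffAt ℝ 2 (fun w => c * F w) v)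
  rw [sphLap_const_mul _ hF, hL] at h1
  have h2 : conf v ^ 2 / 4 * Δ (fun w => conf w ^ (-(1 / 2) : ℝ) * (c * F w)) v = 0 := by
    rw [h1]; ring
  exact (mul_eq_zero.1 h2).resolve_left (by have := conf_pos v; positivity)

lemma continuousAt_laplacian {f : Space → ℝ} (hf : ContDiffAt ℝ 2 f v) :
    ContinuousAt (Δ f) v := by
  rw [InnerProductSpace.laplacian_eq_iteratedFDeriv_stdOrthonormalBasis]
  have hc : ContinuousAt (iteratedFDeriv ℝ 2 f) v :=
    (hf.iteratedFDeriv_right (m := 0) (i := 2) (by norm_num)).continuousAt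
  exact tendsto_finsetSum _ fun i _ =>
    ((ContinuousMultilinearMap.apply ℝ (fun _ : Fin 2 => Space) ℝ _).continuous.tendsto _).comp hc

lemma dense_ne_zero : Dense {v : Space | ∀ i, v i ≠ 0} := by
  intro v
  set γ : ℝ → Space := fun t => v + t • WithLp.toLp 2 (fun _ => (1 : ℝ)) with hγ
  have hc : Tendsto γ (𝓝[≠] 0) (𝓝 v) := by
    have h : ContinuousAt γ 0 := by fun_prop
    have h1 : Tendsto γ (𝓝 0) (𝓝 (γ 0)) := h
    rw [show γ 0 = v by simp [hγ]] at h1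
    exact h1.mono_left nhdsWithin_le_nhds
  refine mem_closure_of_tendsto hc ?_
  refine eventually_all.2 fun i => ?_
  by_cases hi : v i = 0
  · filter_upwards [self_mem_nhdsWithin] with t ht
    simpa [hγ, hi] using ht
  · have h1 : ContinuousAt (fun w : Space => w i) v := by fun_prop
    exact hc.eventually (h1.eventually_ne hi)

/-- G is C², so its Laplacian is continuous; vanishing on the dense complement of the planes, it
vanishes on the whole ball, including A₁ and A₂. -/
theorem harmonicOnNhd_harmonicG (ha : StrictMono a) {u₁ u₂ u₃ : ℝ → ℝ}
    (h : IsRadialTriple a p l₁ l₂ (radialFamily a u₁ u₂ u₃) V) :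
    InnerProductSpace.HarmonicOnNhd (harmonicG a p u₁ u₂ u₃) (Metric.ball (0 : Space) 1) := by
  have key : ∀ v ∈ Metric.ball (0 : Space) 1, Δ (harmonicG a p u₁ u₂ u₃) v = 0 := by
    intro v hv
    have hc := continuousAt_laplacian (contDiffAt_harmonicG ha h hv)
    by_contra hne
    obtain ⟨w, hw0, hw, hwv⟩ := dense_ne_zero.inter_nhds_nonempty
      (inter_mem (hc.eventually_ne hne) (Metric.isOpen_ball.mem_nhds hv))
    exact hw (laplacian_harmonicG_of_ne_zero ha h hwv hw0)
  exact fun v hv => ⟨contDiffAt_harmonicG ha h hv, by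
    filter_upwards [Metric.isOpen_ball.mem_nhds hv] with w hw using key w hw⟩

end Harmonic

/-! ### From the two-parameter eigenvalue problem to radial triples -/

section Eigensystem

variable {a : Fin 4 → ℝ} {p : Fin 3 → Fin 2} {n₂ n₃ : ℕ} {l₁ l₂ : ℝ} {u₁ u₂ u₃ : ℝ → ℝ}

lemma phi_bigOmega_of_mem_Ioo (ha : StrictMono a) (i : Fin 3) {s : ℝ}
    (hs : s ∈ Ioo (a i.castSucc) (a i.succ)) : phi a (bigOmega a s) = s :=
  phi_bigOmega ha ⟨(ha.monotone (Fin.zero_le _)).trans hs.1.le,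
    hs.2.le.trans (ha.monotone (Fin.le_last _))⟩

/-- Since φ inverts Ω, the potentials ±Q(φ(t)) become ±Q(s). The initial values of u₁ at b₁ contain
the boundary condition for p₁, so u₁ and u₂ have the same exponent at a₁. -/
theorem IsEigensystem.isRadialTriple (ha : StrictMono a)
    (hu : IsEigensystem a p n₂ n₃ l₁ l₂ u₁ u₂ u₃) :
    IsRadialTriple a p l₁ l₂ (radialFamily a u₁ u₂ u₃) fun i s =>
      derivWithin (![u₁, u₂, u₃] i) (Icc (b a i.castSucc) (b a i.succ)) (bigOmega a s) where
  radial i := by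
    match i with
    | 0 =>
      refine isRadial_of_solves ha 0 (u := u₁) hu.solves₁ fun s hs => ?_
      rw [phi_bigOmega_of_mem_Ioo ha 0 hs]
      simp [orient]
    | 1 =>
      refine isRadial_of_solves ha 1 (u := u₂) hu.solves₂ fun s hs => ?_
      rw [phi_bigOmega_of_mem_Ioo ha 1 hs]
      simp [orient]
    | 2 =>
      refine isRadial_of_solves ha 2 (u := u₃) hu.solves₃ fun s hs => ?_
      rw [phi_bigOmega_of_mem_Ioo ha 2 hs]
      simp [orient]
  even i j hij hp := by
    match i, j, hij, hp with
    | 0, 0, _, hp => exact (hu.initial_even hp).2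
    | 0, 1, hij, _ => exact absurd hij (by decide)
    | 0, 2, hij, _ => exact absurd hij (by decide)
    | 1, 0, _, hp => exact hu.left₂.1 hp
    | 1, 1, _, hp => exact hu.right₂.1 hp
    | 1, 2, hij, _ => exact absurd hij (by decide)
    | 2, 0, hij, _ => exact absurd hij (by decide)
    | 2, 1, _, hp => exact hu.left₃.1 hp
    | 2, 2, _, hp => exact hu.right₃.1 hp
  odd i j hij hp := by
    match i, j, hij, hp with
    | 0, 0, _, hp => exact (hu.initial_odd hp).1
    | 0, 1, hij, _ => exact absurd hij (by decide)
    | 0, 2, hij, _ => exact absurd hij (by decide)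
    | 1, 0, _, hp => exact hu.left₂.2 hp
    | 1, 1, _, hp => exact hu.right₂.2 hp
    | 1, 2, hij, _ => exact absurd hij (by decide)
    | 2, 0, hij, _ => exact absurd hij (by decide)
    | 2, 1, _, hp => exact hu.left₃.2 hp
    | 2, 2, _, hp => exact hu.right₃.2 hp

end Eigensystem

end FiveCyclide

end

theorem lemma6p1 (a : Fin 4 → ℝ) (ha : StrictMono a) (p : Fin 3 → Fin 2) (n₂ n₃ : ℕ)
    (l₁ l₂ : ℝ) (u₁ u₂ u₃ : ℝ → ℝ)
    (hu : FiveCyclide.IsEigensystem a p n₂ n₃ l₁ l₂ u₁ u₂ u₃) :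
    FiveCyclide.HasParityOn p (FiveCyclide.harmonicG a p u₁ u₂ u₃)
        (Metric.ball (0 : FiveCyclide.Space) 1) ∧
      InnerProductSpace.HarmonicOnNhd (FiveCyclide.harmonicG a p u₁ u₂ u₃)
        (Metric.ball (0 : FiveCyclide.Space) 1) :=
  ⟨FiveCyclide.hasParityOn_harmonicG ha (hu.isRadialTriple ha),
    FiveCyclide.harmonicOnNhd_harmonicG ha (hu.isRadialTriple ha)⟩
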